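/- Conventions. Manifolds are smooth, finite-dimensional and without boundary. A *locally conformal symplectic form* on a manifold $X$ is a smooth nondegenerate $2$-form $\Omega$ on $X$ such that $X$ is covered by open sets $U_a$ carrying smooth positive functions $f_a$ for which each $f_a\,\Omega|_{U_a}$ is symplectic (closed and nondegenerate); for $\dim X\le 2$ the same definition is used. A submanifold $\iota:Q\hookrightarrow M$ of $(M,\Omega)$ is *coisotropic* if $(T_xQ)^{\Omega}=\{v\in T_xM:\Omega(v,w)=0\ \forall w\in T_xQ\}$ is contained in $T_xQ$ for every $x\in Q$; its *characteristic foliation* $\mathcal F$ is the foliation tangent to $(TQ)^{\Omega}\cap TQ=(TQ)^{\Omega}$, and two points are on the same leaf iff they are joined by a piecewise smooth path in $Q$ tangent to this distribution. **Corollary.** Let $M$ be a manifold of dimension $2n>2$ with a locally conformal symplectic form $\Omega$, let $\iota:Q\hookrightarrow M$ be an (embedded) coisotropic submanifold, and let $q\in Q$. Then the germ of $Q$ at $q$ can be reduced: every neighbourhood of $q$ in $Q$ contains an open neighbourhood $U$ of $q$ in $Q$ such that, $\mathcal F$ being the characteristic foliation of the coisotropic submanifold $U$, 1. the leaf space $N=U/\mathcal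 F$ with its quotient topology is a (Hausdorff, second countable) topological space that carries a smooth manifold structure for which the canonical projection $\pi:U\to N$ is a submersion; and 2. for such a structure there are a locally conformal symplectic form $\tau$ on $N$ and a smooth positive function $f$ on $U$ with $$\pi^{*}\tau=f\,(\iota|_U)^{*}\Omega .$$ -/

import Mathlib

open scoped Manifold ContDiff

namespace LCS

noncomputable section

section Forms

variable {k l : ℕ}
  {M : Type*} [TopologicalSpace M] [ChartedSpace (EuclideanSpace ℝ (Fin k)) M]
  {N : Type*} [TopologicalSpace N] [ChartedSpace (EuclideanSpace ℝ (Fin l)) N]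

/-- A (not necessarily continuous) differential `2`-form on a `k`-dimensional manifold `M`. -/
abbrev TwoForm (k : ℕ) (M : Type*) [TopologicalSpace M]
    [ChartedSpace (EuclideanSpace ℝ (Fin k)) M] : Type _ :=
  (x : M) → (TangentSpace (𝓡 k) x) [⋀^Fin 2]→L[ℝ] ℝ

/-- The pullback `g^* τ` of a `2`-form `τ` along a map `g`. It is meaningful at the points where
`g` is differentiable. -/
def pullback (g : M → N) (τ : TwoForm l N) : TwoForm k M := fun x =>
  (τ (g x)).compContinuousLinearMap (mfderiv (𝓡 k) (𝓡 l) g x)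

/-- The local representative `(e⁻¹)^* Ω` of a `2`-form in a chart `e`, as a map from the model
space to alternating forms on the model space. It is meaningful on `e.target`. -/
def chartRep (Ω : TwoForm k M)
    (e : OpenPartialHomeomorph M (EuclideanSpace ℝ (Fin k))) :
    EuclideanSpace ℝ (Fin k) → (EuclideanSpace ℝ (Fin k)) [⋀^Fin 2]→L[ℝ] ℝ := fun y =>
  pullback (k := k) (l := k) (M := EuclideanSpace ℝ (Fin k)) e.symm Ω y

/-- `Ω` is smooth on the open set `U`: all its local representatives are. -/
def IsSmoothOn (Ω : TwoForm k M) (U : Set M) : Prop :=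
  ∀ e ∈ atlas (EuclideanSpace ℝ (Fin k)) M,
    ContDiffOn ℝ ∞ (chartRep Ω e) (e.target ∩ e.symm ⁻¹' U)

/-- `dΩ = 0` on the open set `U`, computed in charts. -/
def IsClosedOn (Ω : TwoForm k M) (U : Set M) : Prop :=
  ∀ e ∈ atlas (EuclideanSpace ℝ (Fin k)) M,
    ∀ y ∈ e.target ∩ e.symm ⁻¹' U, extDeriv (chartRep Ω e) y = 0

/-- `Ω` is nondegenerate at every point of `U`. -/
def IsNondegenerateOn (Ω : TwoForm k M) (U : Set M) : Prop :=
  ∀ x ∈ U, ∀ v : TangentSpace (𝓡 k) x,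
    (∀ w : TangentSpace (𝓡 k) x, Ω x ![v, w] = 0) → v = 0

/-- `Ω` restricts to a symplectic form on the open set `U`. -/
structure IsSymplecticOn (Ω : TwoForm k M) (U : Set M) : Prop where
  smooth : IsSmoothOn Ω U
  closed : IsClosedOn Ω U
  nondegenerate : IsNondegenerateOn Ω U

/-- A locally conformal symplectic form: a smooth nondegenerate `2`-form `Ω` such that the manifold
is covered by open sets `U` carrying smooth positive functions `f` for which `f Ω` is symplectic
on `U`. -/
structure IsLocallyConformalSymplectic (Ω : TwoForm k M) : Prop where
  smooth : IsSmoothOn Ω Set.univ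
  nondegenerate : IsNondegenerateOn Ω Set.univ
  locally_conformal : ∀ x : M, ∃ U : Set M, IsOpen U ∧ x ∈ U ∧
    ∃ f : M → ℝ, ContMDiffOn (𝓡 k) 𝓘(ℝ, ℝ) ∞ f U ∧ (∀ y ∈ U, 0 < f y) ∧
      IsSymplecticOn (fun y => f y • Ω y : TwoForm k M) U

end Forms

section Submanifolds

variable {d k : ℕ}
  {Q : Type*} [TopologicalSpace Q] [ChartedSpace (EuclideanSpace ℝ (Fin d)) Q]
  {M : Type*} [TopologicalSpace M] [ChartedSpace (EuclideanSpace ℝ (Fin k)) M]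

/-- The skew-orthogonal space `(T_x Q)^Ω = {v ∈ T_{ι x} M | Ω(v, w) = 0 for all w ∈ T_x Q}` of a
submanifold `ι : Q → M`; here `T_x Q` is seen in `T_{ι x} M` through the differential of `ι`. -/
def skewOrth (ι : Q → M) (Ω : TwoForm k M) (x : Q) :
    Submodule ℝ (TangentSpace (𝓡 k) (ι x)) where
  carrier := {v | ∀ w : TangentSpace (𝓡 d) x, Ω (ι x) ![v, mfderiv (𝓡 d) (𝓡 k) ι x w] = 0}
  zero_mem' := fun w => (Ω (ι x)).map_coord_zero 0 (by simp)
  add_mem' := fun {a b} ha hb w => by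
    have h := (Ω (ι x)).toMultilinearMap.cons_add
      ![mfderiv (𝓡 d) (𝓡 k) ι x w] a b
    exact h.trans (by
      have h1 := ha w
      have h2 := hb w
      exact (congrArg₂ (· + ·) h1 h2).trans (add_zero 0))
  smul_mem' := fun c a ha w => by
    have h := (Ω (ι x)).toMultilinearMap.cons_smul
      ![mfderiv (𝓡 d) (𝓡 k) ι x w] c a
    exact h.trans ((congrArg (c • ·) (ha w)).trans (smul_zero c))

/-- `ι : Q → M` is coisotropic: `(TQ)^Ω ⊆ TQ` at every point. -/
def IsCoisotropic (d : ℕ) {Q : Type*} [TopologicalSpace Q]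
    [ChartedSpace (EuclideanSpace ℝ (Fin d)) Q] (ι : Q → M) (Ω : TwoForm k M) : Prop :=
  ∀ x : Q, ∀ v ∈ skewOrth (d := d) ι Ω x,
    ∃ w : TangentSpace (𝓡 d) x, mfderiv (𝓡 d) (𝓡 k) ι x w = v

/-- The characteristic distribution `(TQ)^Ω ∩ TQ`, as a family of subspaces of the tangent spaces
of `Q`. -/
def charDist (d : ℕ) {Q : Type*} [TopologicalSpace Q]
    [ChartedSpace (EuclideanSpace ℝ (Fin d)) Q] (ι : Q → M) (Ω : TwoForm k M) (x : Q) :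
    Submodule ℝ (TangentSpace (𝓡 d) x) :=
  (skewOrth (d := d) ι Ω x).comap (mfderiv (𝓡 d) (𝓡 k) ι x).toLinearMap

/-- `x` and `y` are joined by a smooth curve tangent to the distribution `D`. (A smooth path on
`[0, 1]` can be reparametrized to be constant near its ends, so defining the curve on the whole
line is no restriction.) -/
def JoinedAlong (D : (x : Q) → Submodule ℝ (TangentSpace (𝓡 d) x)) (x y : Q) : Prop :=
  ∃ γ : ℝ → Q, ContMDiff 𝓘(ℝ, ℝ) (𝓡 d) ∞ γ ∧ γ 0 = x ∧ γ 1 = y ∧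
    ∀ t : ℝ, mfderiv 𝓘(ℝ, ℝ) (𝓡 d) γ t (1 : ℝ) ∈ D (γ t)

/-- The equivalence relation of lying on the same leaf of the foliation tangent to `D`: being
joined by a piecewise smooth path tangent to `D`. -/
def leafSetoid (D : (x : Q) → Submodule ℝ (TangentSpace (𝓡 d) x)) : Setoid Q :=
  Relation.EqvGen.setoid (JoinedAlong D)

/-- The leaf space `Q / F` of the foliation tangent to `D`, with the quotient topology. -/
abbrev LeafSpace (D : (x : Q) → Submodule ℝ (TangentSpace (𝓡 d) x)) : Type _ :=
  Quotient (leafSetoid D)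

/-- The canonical projection `π : Q → Q / F`. -/
def leafProj (D : (x : Q) → Submodule ℝ (TangentSpace (𝓡 d) x)) : Q → LeafSpace D :=
  Quotient.mk (leafSetoid D)

/-- The locally conformal symplectic structure of `Ω` can be reduced along the submanifold
`ι : Q → M`: the leaf space `N = Q / F` of the characteristic foliation, with its quotient
topology, is a (Hausdorff, second countable) smooth manifold such that `π : Q → N` is a submersion,
and there are a locally conformal symplectic form `τ` on `N` and a smooth positive function `f`
on `Q` with `π^* τ = f ι^* Ω`. -/
def IsReducible (d : ℕ) {Q : Type*} [TopologicalSpace Q]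
    [ChartedSpace (EuclideanSpace ℝ (Fin d)) Q] (ι : Q → M) (Ω : TwoForm k M) : Prop :=
  ∃ (m : ℕ) (_ : ChartedSpace (EuclideanSpace ℝ (Fin m)) (LeafSpace (charDist d ι Ω))),
    IsManifold (𝓡 m) ∞ (LeafSpace (charDist d ι Ω)) ∧
    T2Space (LeafSpace (charDist d ι Ω)) ∧
    SecondCountableTopology (LeafSpace (charDist d ι Ω)) ∧
    Manifold.IsSubmersion (𝓡 d) (𝓡 m) ∞ (leafProj (charDist d ι Ω)) ∧
    ∃ (τ : TwoForm m (LeafSpace (charDist d ι Ω))) (f : Q → ℝ),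
      IsLocallyConformalSymplectic τ ∧
      ContMDiff (𝓡 d) 𝓘(ℝ, ℝ) ∞ f ∧ (∀ x, 0 < f x) ∧
      ∀ x : Q, pullback (k := d) (leafProj (charDist d ι Ω)) τ x
        = f x • pullback (k := d) ι Ω x

end Submanifolds

end

end LCS

/-! Near a point some positive multiple f Ω is closed, and it pulls back to a closed form β on Q
whose kernel is the characteristic distribution. Because Q is coisotropic, this kernel is dual under
Ω to the annihilator of TQ. Kernel vectors at q therefore extend to smooth sections of the kernel:
there are operators X y with image in ker β_y and X 0 = P, the orthogonal projection onto K = ker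
β_0 (`exists_kernel_sections`).

A radial argument takes the place of the Frobenius theorem. Let Φ p be the time-one flow of y ↦ X y
(P p) issued from p - P p. Then dΦ_p (P p) = X (Φ p) (P p) (`exists_flowBox`), so the Euler field R
p = P p along K lies in the kernel of β' = Φ^*β. Since dβ' = 0, Cartan's formula gives L_R β' = 0,
and contracting the K-directions to 0 shows that β' is the pullback of its restriction to the
complement of K (`eq_pullback_of_closed_of_radial`). Nondegeneracy transverse to K is an open
condition, so on a small ball ker β' is exactly K (`exists_normalForm`).

In that ball the leaves are the slices by translates of K, connected because the ball is convex
(`leafSetoid_iff`). The leaf space is then a ball in the complement, and β' restricted to the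
complement is the reduced form, which is even symplectic (`isReducible_of_globalChart`).

Smooth dependence of the flow on p comes from the inverse function theorem for an integral equation
on C([0,1], E), which rests on the smoothness of u ↦ h ∘ u (`contDiff_comp_continuousMap`). -/

namespace LCS

noncomputable section

open Topology

/-! ### Smoothness of composition operators on spaces of continuous maps. -/

section FunctionSpace

universe u

variable {X : Type*} [TopologicalSpace X] [CompactSpace X]
  {E G : Type u} [NormedAddCommGroup E] [NormedSpace ℝ E] [NormedAddCommGroup G] [NormedSpace ℝ G]

/-- Pointwise application of a continuous family of operators to a continuous function, as a
continuous bilinear map. -/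
def pointwiseApply : C(X, E →L[ℝ] G) →L[ℝ] C(X, E) →L[ℝ] C(X, G) :=
  LinearMap.mkContinuous₂
    (LinearMap.mk₂ ℝ (fun (A : C(X, E →L[ℝ] G)) (v : C(X, E)) =>
        (⟨fun x => A x (v x), by fun_prop⟩ : C(X, G)))
      (fun _ _ _ => by ext; simp) (fun _ _ _ => by ext; simp)
      (fun _ _ _ => by ext; simp) (fun _ _ _ => by ext; simp)) 1
    (fun A v => by
      rw [ContinuousMap.norm_le _ (by positivity)]
      intro x
      rw [one_mul]
      exact ((A x).le_opNorm _).trans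
        (by gcongr; exacts [A.norm_coe_le_norm x, v.norm_coe_le_norm x]))

@[simp] theorem pointwiseApply_apply (A : C(X, E →L[ℝ] G)) (v : C(X, E)) (x : X) :
    pointwiseApply A v x = A x (v x) := rfl

/-- The mean value inequality is applied at each point of X. The bound on the variation of `fderiv ℝ
h`, uniform in X, is just the continuity of postcomposition for the sup norm, so E may be
infinite-dimensional. -/
theorem hasFDerivAt_comp_continuousMap (h : E → G) (hh : ContDiff ℝ 1 h) (u : C(X, E)) :
    HasFDerivAt (fun u : C(X, E) => (⟨h, hh.continuous⟩ : C(E, G)).comp u)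
      (pointwiseApply ((⟨fderiv ℝ h, hh.continuous_fderiv one_ne_zero⟩ : C(E, E →L[ℝ] G)).comp u))
      u := by
  set h' : C(E, E →L[ℝ] G) := ⟨fderiv ℝ h, hh.continuous_fderiv one_ne_zero⟩
  have hc : Continuous fun u : C(X, E) => h'.comp u := ContinuousMap.continuous_postcomp h'
  rw [hasFDerivAt_iff_isLittleO_nhds_zero, Asymptotics.isLittleO_iff]
  intro ε hε
  obtain ⟨δ, hδ, hδ'⟩ := (Metric.continuousAt_iff (f := fun u : C(X, E) => h'.comp u)
    (a := u)).1 hc.continuousAt ε hε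
  filter_upwards [Metric.ball_mem_nhds (0 : C(X, E)) hδ] with v hv
  rw [ContinuousMap.norm_le _ (by positivity)]
  intro x
  have key : ∀ z ∈ segment ℝ (u x) (u x + v x), ‖fderiv ℝ h z - fderiv ℝ h (u x)‖ ≤ ε := by
    intro z hz
    rw [segment_eq_image'] at hz
    obtain ⟨θ, hθ, rfl⟩ := hz
    have hw : dist (u + θ • v) u < δ := by
      rw [dist_eq_norm, add_sub_cancel_left, norm_smul, Real.norm_of_nonneg hθ.1]
      rw [mem_ball_zero_iff] at hv
      exact lt_of_le_of_lt (mul_le_of_le_one_left (norm_nonneg _) hθ.2) hv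
    have h1 := hδ' hw
    have h2 := (ContinuousMap.dist_apply_le_dist x).trans h1.le
    rw [dist_eq_norm] at h2
    simpa [h'] using h2
  have := (convex_segment (𝕜 := ℝ) (u x) (u x + v x)).norm_image_sub_le_of_norm_hasFDerivWithin_le'
    (f := h) (f' := fderiv ℝ h) (φ := fderiv ℝ h (u x)) (C := ε)
    (fun z _ => (hh.differentiable one_ne_zero z).hasFDerivAt.hasFDerivWithinAt) key
    (left_mem_segment ℝ _ _) (right_mem_segment ℝ _ _)
  rw [add_sub_cancel_left] at this
  refine le_trans (le_of_eq ?_) (this.trans (mul_le_mul_of_nonneg_left (v.norm_coe_le_norm x) hε.le))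
  simp [h']

/-- Induction over all targets at once: the derivative is composition with `fderiv ℝ h` followed by
the continuous linear `pointwiseApply`. E and G share a universe so that `E →L[ℝ] G` is again an
admissible target. -/
theorem contDiff_nat_comp_continuousMap (n : ℕ) : ∀ {G : Type u} [NormedAddCommGroup G]
    [NormedSpace ℝ G] (h : E → G) (hh : ContDiff ℝ n h),
    ContDiff ℝ n (fun u : C(X, E) => (⟨h, hh.continuous⟩ : C(E, G)).comp u) := by
  induction n with
  | zero =>
    intro G _ _ h hh
    exact contDiff_zero.2 (ContinuousMap.continuous_postcomp _)
  | succ n ih =>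
    intro G _ _ h hh
    have h1 : ContDiff ℝ 1 h := hh.of_le (by exact_mod_cast Nat.le_add_left 1 n)
    have hd := hasFDerivAt_comp_continuousMap (X := X) h h1
    have hf : ContDiff ℝ n (fderiv ℝ h) := hh.fderiv_right (by norm_cast)
    refine (contDiff_succ_iff_fderiv (𝕜 := ℝ) (n := n)).2 ?_
    refine ⟨fun u => (hd u).differentiableAt, by simp, ?_⟩
    have : fderiv ℝ (fun u : C(X, E) => (⟨h, hh.continuous⟩ : C(E, G)).comp u) =
        fun u => pointwiseApply ((⟨fderiv ℝ h, hf.continuous⟩ : C(E, E →L[ℝ] G)).comp u) :=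
      funext fun u => (hd u).fderiv
    rw [this]
    exact pointwiseApply.contDiff.comp (ih _ hf)

theorem contDiff_comp_continuousMap (h : E → G) (hh : ContDiff ℝ ∞ h) :
    ContDiff ℝ ∞ (fun u : C(X, E) => (⟨h, hh.continuous⟩ : C(E, G)).comp u) :=
  contDiff_infty.2 fun n => contDiff_nat_comp_continuousMap n h (contDiff_infty.1 hh n)

end FunctionSpace

/-! ### Integration as a bounded operator on C([0,1], E). -/

section Primitive

variable {E : Type*} [NormedAddCommGroup E] [NormedSpace ℝ E]

open unitInterval

omit [NormedSpace ℝ E] in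
theorem continuous_extend (v : C(I, E)) : Continuous (Set.IccExtend zero_le_one v : ℝ → E) :=
  v.continuous.Icc_extend'

/-- The primitive vanishing at `0` of a continuous function on the unit interval. -/
def primitive : C(I, E) →L[ℝ] C(I, E) :=
  LinearMap.mkContinuous
    { toFun := fun v => ⟨fun t => ∫ s in (0 : ℝ)..t, Set.IccExtend zero_le_one v s,
        (intervalIntegral.continuous_primitive
          (fun a b => (continuous_extend v).intervalIntegrable a b) 0).comp
          continuous_subtype_val⟩
      map_add' := fun v w => by
        ext t
        simp only [ContinuousMap.coe_mk, ContinuousMap.add_apply]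
        rw [← intervalIntegral.integral_add ((continuous_extend v).intervalIntegrable _ _)
          ((continuous_extend w).intervalIntegrable _ _)]
        rfl
      map_smul' := fun c v => by
        ext t
        simp only [ContinuousMap.coe_mk, ContinuousMap.smul_apply, RingHom.id_apply]
        rw [← intervalIntegral.integral_smul]
        rfl } 1
    (fun v => by
      rw [ContinuousMap.norm_le _ (by positivity)]
      intro t
      have := intervalIntegral.norm_integral_le_of_norm_le_const (a := 0) (b := (t : ℝ))
        (f := Set.IccExtend zero_le_one v) (C := ‖v‖) (fun s _ => v.norm_coe_le_norm _)
      refine this.trans ?_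
      rw [sub_zero, abs_of_nonneg t.2.1, one_mul]
      exact mul_le_of_le_one_right (norm_nonneg _) t.2.2)

theorem primitive_apply (v : C(I, E)) (t : I) :
    primitive v t = ∫ s in (0 : ℝ)..t, Set.IccExtend zero_le_one v s := rfl

end Primitive

/-! ### Time-one flow coordinates via the inverse function theorem. -/

section FlowBox

open unitInterval

/-- The inverse function theorem with the source cut down to the open set where the derivative is
invertible, so that the inverse is smooth on the whole target and not only at one point. -/
theorem exists_openPartialHomeomorph_of_contDiffOn {E F : Type*} [NormedAddCommGroup E]
    [NormedSpace ℝ E] [CompleteSpace E] [NormedAddCommGroup F] [NormedSpace ℝ F] {f : E → F}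
    {s : Set E} {a : E} (hs : IsOpen s) (hf : ContDiffOn ℝ ∞ f s) (ha : a ∈ s) (f' : E ≃L[ℝ] F)
    (hf' : HasFDerivAt f (f' : E →L[ℝ] F) a) :
    ∃ Φ : OpenPartialHomeomorph E F, (∀ x, Φ x = f x) ∧ a ∈ Φ.source ∧ Φ.source ⊆ s ∧
      (∀ x ∈ Φ.source, ∃ e : E ≃L[ℝ] F, fderiv ℝ f x = e) ∧ ContDiffOn ℝ ∞ Φ.symm Φ.target := by
  have hfa : ContDiffAt ℝ ∞ f a := hf.contDiffAt (hs.mem_nhds ha)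
  have hopen : IsOpen (s ∩ fderiv ℝ f ⁻¹' Set.range ((↑) : (E ≃L[ℝ] F) → E →L[ℝ] F)) :=
    (hf.continuousOn_fderiv_of_isOpen hs (by simp)).isOpen_inter_preimage hs
      (ContinuousLinearEquiv.isOpen)
  have hn : (∞ : WithTop ℕ∞) ≠ 0 := by simp
  refine ⟨(hfa.toOpenPartialHomeomorph f hf' hn).restrOpen _ hopen, fun x => rfl, ?_, ?_, ?_, ?_⟩
  · refine ⟨hfa.mem_toOpenPartialHomeomorph_source hf' hn, ha, f', ?_⟩
    exact hf'.fderiv.symm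
  · exact fun x hx => hx.2.1
  · rintro x ⟨-, -, e, he⟩
    exact ⟨e, he.symm⟩
  · intro y hy
    set Φ := (hfa.toOpenPartialHomeomorph f hf' hn).restrOpen _ hopen with hΦ
    obtain ⟨-, hxs, e, he⟩ := Φ.map_target hy
    have h1 : ContDiffAt ℝ ∞ Φ (Φ.symm y) := hf.contDiffAt (hs.mem_nhds hxs)
    refine (Φ.contDiffAt_symm (f₀' := e) hy ?_ h1).contDiffWithinAt
    have := (h1.differentiableAt hn).hasFDerivAt
    rwa [show fderiv ℝ Φ (Φ.symm y) = e from he.symm] at this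

/-- The shear `(v, q) ↦ (v - A q, q)`. -/
def shear {C E : Type*} [NormedAddCommGroup C] [NormedSpace ℝ C] [NormedAddCommGroup E]
    [NormedSpace ℝ E] (A : E →L[ℝ] C) : (C × E) ≃L[ℝ] (C × E) :=
  ContinuousLinearEquiv.equivOfInverse
    ((ContinuousLinearMap.fst ℝ C E - A ∘L ContinuousLinearMap.snd ℝ C E).prod
      (ContinuousLinearMap.snd ℝ C E))
    ((ContinuousLinearMap.fst ℝ C E + A ∘L ContinuousLinearMap.snd ℝ C E).prod
      (ContinuousLinearMap.snd ℝ C E))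
    (fun x => by ext <;> simp) (fun x => by ext <;> simp)

section FlowBox

variable {E : Type*} [NormedAddCommGroup E] [NormedSpace ℝ E]

/-- The integral equation for the time-one flow of the vector fields `y ↦ X y (P p)` issued
from `p - P p`. -/
def flowEq (X : C(E, E →L[ℝ] E)) (P : E →L[ℝ] E) (z : C(I, E) × E) : C(I, E) × E :=
  (z.1 - ContinuousLinearMap.const ℝ I (z.2 - P z.2) -
    primitive (pointwiseApply (X.comp z.1) (ContinuousLinearMap.const ℝ I (P z.2))), z.2)

theorem contDiff_flowEq (X : C(E, E →L[ℝ] E)) (hX : ContDiff ℝ ∞ X) (P : E →L[ℝ] E) :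
    ContDiff ℝ ∞ (flowEq X P) := by
  have h1 : ContDiff ℝ ∞ fun z : C(I, E) × E => X.comp z.1 :=
    (contDiff_comp_continuousMap (X := I) X hX).comp contDiff_fst
  have h2 : ContDiff ℝ ∞ fun z : C(I, E) × E => ContinuousLinearMap.const ℝ I (P z.2) :=
    (ContinuousLinearMap.const ℝ I ∘L P).contDiff.comp contDiff_snd
  have h3 : ContDiff ℝ ∞ fun z : C(I, E) × E => ContinuousLinearMap.const ℝ I (z.2 - P z.2) :=
    (ContinuousLinearMap.const ℝ I).contDiff.comp
      (contDiff_snd.sub (P.contDiff.comp contDiff_snd))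
  have h4 : ContDiff ℝ ∞ fun z : C(I, E) × E => 
      pointwiseApply (X.comp z.1) (ContinuousLinearMap.const ℝ I (P z.2)) :=
    ContDiff.clm_apply (ContDiff.comp (g := pointwiseApply (X := I) (E := E) (G := E))
      (ContinuousLinearMap.contDiff _) h1) h2
  exact ((contDiff_fst.sub h3).sub (primitive.contDiff.comp h4)).prodMk contDiff_snd

theorem flowEq_zero (X : C(E, E →L[ℝ] E)) (P : E →L[ℝ] E) : flowEq X P 0 = 0 := by
  simp [flowEq]

/-- At the origin the factor P z.2 vanishes, so the derivative of the operator family drops out and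
only X 0 = P, applied to P q, survives. What remains is a shear, hence invertible. -/
theorem hasFDerivAt_flowEq_zero (X : C(E, E →L[ℝ] E)) (hX : ContDiff ℝ ∞ X) (P : E →L[ℝ] E)
    (hP : P ∘L P = P) (hX0 : X 0 = P) :
    HasFDerivAt (flowEq X P) (shear (ContinuousLinearMap.const ℝ I ∘L (.id ℝ E - P) +
      primitive ∘L ContinuousLinearMap.const ℝ I ∘L P) : C(I, E) × E →L[ℝ] C(I, E) × E) 0 := by
  have h1 : ContDiff ℝ ∞ fun z : C(I, E) × E => pointwiseApply (X.comp z.1) :=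
    ContDiff.comp (g := pointwiseApply (X := I) (E := E) (G := E)) (ContinuousLinearMap.contDiff _)
      ((contDiff_comp_continuousMap (X := I) X hX).comp contDiff_fst)
  have h1' := (h1.differentiable (by simp) 0).hasFDerivAt
  have h2 : HasFDerivAt (fun z : C(I, E) × E => ContinuousLinearMap.const ℝ I (P z.2))
      (ContinuousLinearMap.const ℝ I ∘L P ∘L ContinuousLinearMap.snd ℝ _ _) 0 :=
    (ContinuousLinearMap.const ℝ I ∘L P ∘L ContinuousLinearMap.snd ℝ C(I, E) E).hasFDerivAt
  have h3 : HasFDerivAt (fun z : C(I, E) × E => ContinuousLinearMap.const ℝ I (z.2 - P z.2))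
      (ContinuousLinearMap.const ℝ I ∘L (.id ℝ E - P) ∘L ContinuousLinearMap.snd ℝ _ _) 0 :=
    (ContinuousLinearMap.const ℝ I ∘L (.id ℝ E - P) ∘L
      ContinuousLinearMap.snd ℝ C(I, E) E).hasFDerivAt
  have h4 := h1'.clm_apply h2
  have h5 := ((hasFDerivAt_fst.sub h3).sub (primitive.hasFDerivAt.comp (0 : C(I, E) × E) h4)).prodMk
    (hasFDerivAt_snd (p := (0 : C(I, E) × E)))
  refine HasFDerivAt.congr_fderiv (f := flowEq X P) h5 ?_
  have hpw : ∀ q : E, pointwiseApply (ContinuousMap.const I (X 0)) (ContinuousLinearMap.const ℝ I (P q)) =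
      ContinuousLinearMap.const ℝ I (P q) := by
    intro q
    ext t
    simp [hX0]
    exact DFunLike.congr_fun hP q
  refine ContinuousLinearMap.ext fun z => Prod.ext ?_ rfl
  simp [shear, hpw, sub_sub]

variable [CompleteSpace E]

/-- Local coordinates adapted to the vector fields `X y v`, constructed with the time-one flow. -/
theorem exists_flowBox (X : E → E →L[ℝ] E) (hX : ContDiff ℝ ∞ X) (P : E →L[ℝ] E)
    (hP : P ∘L P = P) (hX0 : X 0 = P) :
    ∃ Φ : OpenPartialHomeomorph E E, 0 ∈ Φ.source ∧ Φ 0 = 0 ∧ ContDiffOn ℝ ∞ Φ Φ.source ∧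
      ContDiffOn ℝ ∞ Φ.symm Φ.target ∧ HasFDerivAt Φ (.id ℝ E : E →L[ℝ] E) 0 ∧
      ∀ p ∈ Φ.source, fderiv ℝ Φ p (P p) = X (Φ p) (P p) := by
  set Xc : C(E, E →L[ℝ] E) := ⟨X, hX.continuous⟩
  set A : E →L[ℝ] C(I, E) := ContinuousLinearMap.const ℝ I ∘L (.id ℝ E - P) +
      primitive ∘L ContinuousLinearMap.const ℝ I ∘L P with hA
  have hFs := contDiff_flowEq Xc hX P
  -- Inverting at (0, p) gives (u p, p), where u p is the integral curve with parameter p; its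
  -- smoothness in p is that of `Ψ.symm`.
  obtain ⟨Ψ, hΨ, h0, -, -, hΨs⟩ := exists_openPartialHomeomorph_of_contDiffOn isOpen_univ
    hFs.contDiffOn (Set.mem_univ 0) _ (hasFDerivAt_flowEq_zero Xc hX P hP hX0)
  have h0t : (0 : C(I, E) × E) ∈ Ψ.target := by
    have := Ψ.map_source h0
    rwa [hΨ, flowEq_zero] at this
  have hsymm0 : Ψ.symm 0 = 0 := by
    have := Ψ.left_inv h0
    rwa [hΨ, flowEq_zero] at this
  have hsnd : ∀ z ∈ Ψ.target, (Ψ.symm z).2 = z.2 := by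
    intro z hz
    have := Ψ.right_inv hz
    rw [hΨ] at this
    have h2 : (flowEq Xc P (Ψ.symm z)).2 = (Ψ.symm z).2 := rfl
    rw [← h2, this]
  let j : E →L[ℝ] C(I, E) × E := ContinuousLinearMap.inr ℝ _ _
  let u : E → C(I, E) := fun p => (Ψ.symm (j p)).1
  set D : Set E := j ⁻¹' Ψ.target with hD
  have hDo : IsOpen D := Ψ.open_target.preimage j.continuous
  have h0D : (0 : E) ∈ D := by
    change j 0 ∈ Ψ.target
    rwa [map_zero]
  have hus : ContDiffOn ℝ ∞ u D := contDiff_fst.comp_contDiffOn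
    (hΨs.comp j.contDiff.contDiffOn (fun p hp => hp))
  have hu0 : u 0 = 0 := by simp [u, hsymm0]
  have hueq : ∀ p ∈ D, flowEq Xc P (u p, p) = (0, p) := by
    intro p hp
    have h := Ψ.right_inv hp
    rw [hΨ] at h
    have h2 : Ψ.symm (j p) = (u p, p) := Prod.ext rfl (hsnd _ hp)
    rw [h2] at h
    exact h
  have huval : ∀ p ∈ D, ∀ t : I, u p t = p - P p + ∫ s in (0 : ℝ)..t,
      Set.IccExtend zero_le_one (pointwiseApply (Xc.comp (u p))
        (ContinuousLinearMap.const ℝ I (P p))) s := by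
    intro p hp t
    have h := DFunLike.congr_fun (congrArg Prod.fst (hueq p hp)) t
    simp only [flowEq, ContinuousMap.sub_apply, primitive_apply, ContinuousMap.zero_apply] at h
    rw [sub_sub, sub_eq_zero] at h
    exact h
  let e1 : C(I, E) →L[ℝ] E := ContinuousMap.evalCLM ℝ (1 : I)
  let f : E → E := fun p => e1 (u p)
  have hfs : ContDiffOn ℝ ∞ f D := e1.contDiff.comp_contDiffOn hus
  have hf0 : f 0 = 0 := by simp [f, hu0]
  -- At time 1 the linearized solution A q takes the value (q - P q) + P q = q.
  have hf' : HasFDerivAt f (.id ℝ E : E →L[ℝ] E) 0 := by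
    have h1 : HasFDerivAt Ψ.symm ((shear A).symm : C(I, E) × E →L[ℝ] C(I, E) × E) 0 := by
      refine Ψ.hasFDerivAt_symm h0t ?_
      rw [hsymm0, show (Ψ : C(I, E) × E → C(I, E) × E) = flowEq Xc P from funext hΨ]
      exact hasFDerivAt_flowEq_zero Xc hX P hP hX0
    have h2 : HasFDerivAt (fun p => Ψ.symm (j p)) _ (0 : E) :=
      HasFDerivAt.comp (0 : E) (g := Ψ.symm) (f := j) (by rw [map_zero]; exact h1) j.hasFDerivAt
    have h3 := (e1 ∘L ContinuousLinearMap.fst ℝ _ _).hasFDerivAt.comp 0 h2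
    refine HasFDerivAt.congr_fderiv (f := f) h3 ?_
    ext q
    have : (shear A).symm (j q) = (A q, q) := by
      rw [ContinuousLinearEquiv.symm_apply_eq]
      simp [shear, j]
    simp only [ContinuousLinearMap.comp_apply, ContinuousLinearEquiv.coe_coe, this]
    have h4 : e1 (primitive (ContinuousLinearMap.const ℝ I (P q))) = P q := by
      change ∫ s in (0 : ℝ)..1, P q = P q
      simp
    simp only [hA, add_apply, ContinuousLinearMap.comp_apply,
      ContinuousLinearMap.coe_fst', map_add, h4]
    simp [e1]
  -- the radial property
  obtain ⟨ε, hε, hball⟩ := Metric.isOpen_iff.1 Ψ.open_source 0 h0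
  have hnear : ∀ᶠ p in 𝓝 (0 : E), p ∈ D ∧ ‖u p‖ < ε ∧ ‖p - P p‖ + ‖P p‖ < ε := by
    have hc1 : Filter.Tendsto (fun p => ‖u p‖) (𝓝 0) (𝓝 0) := by
      have := (hus.continuousOn.continuousAt (hDo.mem_nhds h0D)).norm
      simpa [ContinuousAt, hu0] using this
    have hc2 : Filter.Tendsto (fun p => ‖p - P p‖ + ‖P p‖) (𝓝 0) (𝓝 0) := by
      have : Continuous (fun p => ‖p - P p‖ + ‖P p‖) := by fun_prop
      simpa using this.tendsto 0
    exact Filter.Eventually.and (hDo.mem_nhds h0D)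
      ((hc1.eventually_lt_const hε).and (hc2.eventually_lt_const hε))
  obtain ⟨r, hr, hrball⟩ := Metric.eventually_nhds_iff_ball.1 hnear
  have hrad : ∀ p ∈ Metric.ball (0 : E) r, ∀ t : I, f (p - P p + (t : ℝ) • P p) = u p t := by
    intro p hp t
    obtain ⟨hpD, hpu, hpn⟩ := hrball p hp
    -- Time rescaling: s ↦ u p (t s) solves the equation with parameter pt, because P pt = t • P p.
    -- The rescaled pair stays in the ε-ball inside `Ψ.source`, so injectivity of Ψ there identifies
    -- it with the solution at pt.
    let ut : C(I, E) := (u p).comp ⟨fun s => t * s, by fun_prop⟩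
    set pt : E := p - P p + (t : ℝ) • P p with hpt
    have hPp : P (P p) = P p := DFunLike.congr_fun hP p
    have hPpt : P pt = (t : ℝ) • P p := by simp [hpt, hPp]
    have hmem : (ut, pt) ∈ Ψ.source := by
      apply hball
      rw [mem_ball_zero_iff, Prod.norm_def, max_lt_iff]
      constructor
      · refine lt_of_le_of_lt ?_ hpu
        rw [ContinuousMap.norm_le _ (norm_nonneg _)]
        exact fun s => (u p).norm_coe_le_norm _
      · refine lt_of_le_of_lt ((norm_add_le _ _).trans ?_) hpn
        gcongr
        rw [norm_smul, Real.norm_of_nonneg t.2.1]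
        exact mul_le_of_le_one_left (norm_nonneg _) t.2.2
    have heq : Ψ (ut, pt) = j pt := by
      rw [hΨ]
      refine Prod.ext (ContinuousMap.ext fun s => ?_) rfl
      simp only [flowEq, ContinuousMap.sub_apply, primitive_apply, hPpt]
      change u p (t * s) - (pt - (t : ℝ) • P p) - _ = 0
      rw [huval p hpD, sub_sub, sub_eq_zero, hpt, add_sub_cancel_right]
      congr 1
      have h1 := intervalIntegral.smul_integral_comp_mul_left (a := 0) (b := (s : ℝ))
        (Set.IccExtend zero_le_one (pointwiseApply (Xc.comp (u p))
          (ContinuousLinearMap.const ℝ I (P p)))) (t : ℝ)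
      rw [mul_zero] at h1
      rw [Set.Icc.coe_mul, ← h1, ← intervalIntegral.integral_smul]
      refine intervalIntegral.integral_congr fun x hx => ?_
      rw [Set.uIcc_of_le s.2.1] at hx
      have hxI : x ∈ Set.Icc (0 : ℝ) 1 := ⟨hx.1, hx.2.trans s.2.2⟩
      have htx : (t : ℝ) * x ∈ Set.Icc (0 : ℝ) 1 :=
        ⟨mul_nonneg t.2.1 hxI.1, mul_le_one₀ t.2.2 hxI.1 hxI.2⟩
      rw [Set.IccExtend_of_mem _ _ hxI, Set.IccExtend_of_mem _ _ htx]
      simp [ut]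
      rfl
    have h2 : Ψ.symm (j pt) = (ut, pt) := by rw [← heq, Ψ.left_inv hmem]
    change u pt 1 = _
    simp [u, h2, ut]
  have hder : ∀ p ∈ Metric.ball (0 : E) r, fderiv ℝ f p (P p) = X (f p) (P p) := by
    intro p hp
    obtain ⟨hpD, -, -⟩ := hrball p hp
    set w := pointwiseApply (Xc.comp (u p)) (ContinuousLinearMap.const ℝ I (P p)) with hw
    have hfp : HasFDerivAt f (fderiv ℝ f p) p :=
      ((hfs.contDiffAt (hDo.mem_nhds hpD)).differentiableAt (by simp)).hasFDerivAt
    have h1 : HasDerivAt (fun t : ℝ => f (p - P p + t • P p)) (fderiv ℝ f p (P p)) 1 := by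
      have hl : HasDerivAt (fun t : ℝ => p - P p + t • P p) (P p) 1 := by
        simpa using ((hasDerivAt_id (1 : ℝ)).smul_const (P p)).const_add (p - P p)
      have hfp' : HasFDerivAt f (fderiv ℝ f p) (p - P p + (1 : ℝ) • P p) := by simpa using hfp
      exact hfp'.comp_hasDerivAt 1 hl
    have h2 : HasDerivAt (fun t : ℝ => p - P p + ∫ s in (0 : ℝ)..t,
        Set.IccExtend zero_le_one w s) (Set.IccExtend zero_le_one w 1) 1 := by
      refine HasDerivAt.const_add _ ?_
      exact intervalIntegral.integral_hasDerivAt_right ((continuous_extend w).intervalIntegrable _ _)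
        ((continuous_extend w).stronglyMeasurableAtFilter _ _) (continuous_extend w).continuousAt
    -- The curve is known only on [0, 1], so at the endpoint 1 the derivatives are compared within
    -- that interval.
    have h3 : HasDerivWithinAt (fun t : ℝ => f (p - P p + t • P p))
        (Set.IccExtend zero_le_one w 1) (Set.Icc 0 1) 1 := by
      refine h2.hasDerivWithinAt.congr_of_mem (fun t ht => ?_) (by simp)
      rw [← huval p hpD ⟨t, ht⟩, ← hrad p hp ⟨t, ht⟩]
    have h4 := (uniqueDiffOn_Icc (zero_lt_one' ℝ) 1 (by simp)).eq_deriv _ h1.hasDerivWithinAt h3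
    rw [h4, Set.IccExtend_of_mem _ _ (by simp)]
    rfl
  obtain ⟨Φ, hΦ, hΦ0, hΦsub, -, hΦs⟩ := exists_openPartialHomeomorph_of_contDiffOn
    (Metric.isOpen_ball.inter hDo)
    (hfs.mono (Set.inter_subset_right (s := Metric.ball (0 : E) r)))
    ⟨Metric.mem_ball_self hr, h0D⟩ (ContinuousLinearEquiv.refl ℝ E) hf'
  have hΦf : (Φ : E → E) = f := funext hΦ
  refine ⟨Φ, hΦ0, by rw [hΦf, hf0], ?_, hΦs, by rw [hΦf]; exact hf', ?_⟩
  · rw [hΦf]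
    exact hfs.mono (hΦsub.trans Set.inter_subset_right)
  · intro p hp
    rw [hΦf]
    exact hder p (hΦsub hp).1

end FlowBox

end FlowBox

theorem exists_continuousLinearMap_leftInverse {A B : Type*} [NormedAddCommGroup A]
    [NormedSpace ℝ A] [NormedAddCommGroup B] [NormedSpace ℝ B] [FiniteDimensional ℝ B]
    (f : A →L[ℝ] B) (hf : Function.Injective f) : ∃ L : B →L[ℝ] A, ∀ x, L (f x) = x := by
  obtain ⟨L, hL⟩ := LinearMap.exists_leftInverse_of_injective f.toLinearMap
    (LinearMap.ker_eq_bot.2 hf)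
  exact ⟨LinearMap.toContinuousLinearMap L, LinearMap.congr_fun hL⟩

theorem eventually_injective_add {A B Y : Type*} [NormedAddCommGroup A]
    [NormedSpace ℝ A] [FiniteDimensional ℝ A] [NormedAddCommGroup B] [NormedSpace ℝ B]
    [TopologicalSpace Y] {a : Y → A →L[ℝ] B} {b : A →L[ℝ] B} {y : Y} (ha : ContinuousAt a y)
    (hinj : Function.Injective fun v => a y v + b v) :
    ∀ᶠ z in 𝓝 y, Function.Injective fun v => a z v + b v :=
  (ha.add (continuousAt_const (y := b))).eventually
    (ContinuousLinearMap.isOpen_injective.mem_nhds hinj)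

/-! ### Two-forms on normed spaces, and closed forms killed by a radial field. -/

section FlatForms

variable {E F : Type*} [NormedAddCommGroup E] [NormedSpace ℝ E]
  [NormedAddCommGroup F] [NormedSpace ℝ F]

/-- The bilinear form underlying an alternating `2`-form. -/
def bil : (E [⋀^Fin 2]→L[ℝ] ℝ) →L[ℝ] E →L[ℝ] E →L[ℝ] ℝ :=
  (ContinuousLinearMap.compL ℝ E (E [⋀^Fin 1]→L[ℝ] ℝ) (E →L[ℝ] ℝ)
    (ContinuousAlternatingMap.ofSubsingletonLIE (𝕜 := ℝ) (E := E) (F := ℝ)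
      (0 : Fin 1)).symm.toContinuousLinearEquiv.toContinuousLinearMap) ∘L
    ContinuousAlternatingMap.curryLeftLI.toContinuousLinearMap

theorem bil_apply (f : E [⋀^Fin 2]→L[ℝ] ℝ) (v w : E) : bil f v w = f ![v, w] := by
  change f (Matrix.vecCons v fun _ => w) = f ![v, w]
  congr 1
  ext i
  fin_cases i <;> rfl

theorem bil_injective : Function.Injective (bil (E := E)) := by
  intro f g h
  ext v
  have hv : v = ![v 0, v 1] := List.ofFn_inj.1 rfl
  have := DFunLike.congr_fun (DFunLike.congr_fun h (v 0)) (v 1)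
  rw [bil_apply, bil_apply] at this
  rwa [hv]

theorem contDiff_bil : ContDiff ℝ ∞ fun f : E [⋀^Fin 2]→L[ℝ] ℝ => bil f := by fun_prop

theorem continuousAt_bil {Y : Type*} [TopologicalSpace Y] {a : Y → E [⋀^Fin 2]→L[ℝ] ℝ} {y : Y}
    (ha : ContinuousAt a y) : ContinuousAt (fun z => bil (a z)) y :=
  (contDiff_bil (E := E)).continuous.continuousAt.comp ha

theorem bil_swap (f : E [⋀^Fin 2]→L[ℝ] ℝ) (v w : E) : bil f v w = -bil f w v := by
  rw [bil_apply, bil_apply]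
  have := f.toAlternatingMap.map_swap ![w, v] (i := 0) (j := 1) (by simp)
  have h2 : (![w, v] ∘ Equiv.swap 0 1) = ![v, w] := List.ofFn_inj.1 (by simp)
  rw [h2] at this
  exact this

theorem bil_compContinuousLinearMap (f : F [⋀^Fin 2]→L[ℝ] ℝ) (A : E →L[ℝ] F) (v w : E) :
    bil (f.compContinuousLinearMap A) v w = bil f (A v) (A w) := by
  rw [bil_apply, bil_apply]
  change f (A ∘ ![v, w]) = _
  congr 1
  ext i
  fin_cases i <;> rfl

/-- `bil` is linear and injective into a finite-dimensional space, so a continuous linear left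
inverse carries smoothness back to the form. -/
theorem contDiffOn_of_bil [FiniteDimensional ℝ E] {β : F → E [⋀^Fin 2]→L[ℝ] ℝ} {s : Set F}
    (h : ContDiffOn ℝ ∞ (fun y => bil (β y)) s) : ContDiffOn ℝ ∞ β s := by
  obtain ⟨L', hL'⟩ := exists_continuousLinearMap_leftInverse
    (A := E [⋀^Fin 2]→L[ℝ] ℝ) (B := E →L[ℝ] E →L[ℝ] ℝ) (bil (E := E)) bil_injective
  have hLs : ContDiff ℝ ∞ fun b => L' b := by fun_prop
  exact (hLs.comp_contDiffOn h).congr fun y _ => (hL' (β y)).symm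

/-- The pullback of a `2`-form along a map of normed spaces. -/
def flatPullback (g : E → F) (η : F → F [⋀^Fin 2]→L[ℝ] ℝ) (y : E) : E [⋀^Fin 2]→L[ℝ] ℝ :=
  (η (g y)).compContinuousLinearMap (fderiv ℝ g y)

theorem bil_flatPullback (g : E → F) (η : F → F [⋀^Fin 2]→L[ℝ] ℝ) (y v w : E) :
    bil (flatPullback g η y) v w = bil (η (g y)) (fderiv ℝ g y v) (fderiv ℝ g y w) :=
  bil_compContinuousLinearMap _ _ _ _

theorem contDiffOn_flatPullback [FiniteDimensional ℝ E] {g : E → F}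
    {η : F → F [⋀^Fin 2]→L[ℝ] ℝ} {s : Set E} {t : Set F} (hs : IsOpen s)
    (hη : ContDiffOn ℝ ∞ η t) (hg : ContDiffOn ℝ ∞ g s) (hst : Set.MapsTo g s t) :
    ContDiffOn ℝ ∞ (flatPullback g η) s := by
  apply contDiffOn_of_bil
  have hA : ContDiffOn ℝ ∞ (fderiv ℝ g) s := hg.fderiv_of_isOpen hs (by simp)
  have hB : ContDiffOn ℝ ∞ (fun y => bil (η (g y))) s :=
    contDiff_bil.comp_contDiffOn (hη.comp hg hst)
  have hC : ContDiffOn ℝ ∞ (fun y => (ContinuousLinearMap.compL ℝ E F ℝ).flip (fderiv ℝ g y)) s :=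
    by fun_prop
  refine (hC.clm_comp (hB.clm_comp hA)).congr fun y _ => ?_
  ext v w
  rw [bil_flatPullback]
  rfl

theorem extDeriv_flatPullback {g : E → F} {η : F → F [⋀^Fin 2]→L[ℝ] ℝ} {s : Set E} {t : Set F}
    (hs : IsOpen s) (ht : IsOpen t) (hη : ContDiffOn ℝ ∞ η t) (hg : ContDiffOn ℝ ∞ g s)
    (hst : Set.MapsTo g s t) (hd : ∀ y ∈ t, extDeriv η y = 0) :
    ∀ y ∈ s, extDeriv (flatPullback g η) y = 0 := by
  intro y hy
  have h := extDeriv_pullback (𝕜 := ℝ) (r := ∞)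
    ((hη.contDiffAt (ht.mem_nhds (hst hy))).differentiableAt (by simp))
    (hg.contDiffAt (hs.mem_nhds hy)) (by simp [ENat.LEInfty.out])
  refine h.trans ?_
  rw [hd _ (hst hy)]
  rfl

theorem extDeriv_apply_three {β : E → E [⋀^Fin 2]→L[ℝ] ℝ} {y : E} (h : DifferentiableAt ℝ β y)
    (a b c : E) : extDeriv β y ![a, b, c] = bil (fderiv ℝ β y a) b c - bil (fderiv ℝ β y b) a c +
      bil (fderiv ℝ β y c) a b := by
  rw [extDeriv_apply h, Fin.sum_univ_three, bil_apply, bil_apply, bil_apply]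
  have h0 : (0 : Fin 3).removeNth ![a, b, c] = ![b, c] := by
    ext i; fin_cases i <;> rfl
  have h1 : (1 : Fin 3).removeNth ![a, b, c] = ![a, c] := by
    ext i; fin_cases i <;> rfl
  have h2 : (2 : Fin 3).removeNth ![a, b, c] = ![a, b] := by
    ext i; fin_cases i <;> rfl
  rw [h0, h1, h2]
  simp only [fderiv_continuousAlternatingMap_apply_const_apply h]
  simp
  ring

theorem hasDerivAt_bil {β : E → E [⋀^Fin 2]→L[ℝ] ℝ} {β' : E →L[ℝ] E [⋀^Fin 2]→L[ℝ] ℝ}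
    {c : ℝ → E} {c' : E} {t : ℝ} (hβ : HasFDerivAt β β' (c t)) (hc : HasDerivAt c c' t) (a b : E) :
    HasDerivAt (fun t => bil (β (c t)) a b) (bil (β' c') a b) t := by
  have h1 := (hβ.continuousAlternatingMap_apply_const ![a, b]).comp_hasDerivAt t hc
  simp only [bil_apply]
  exact h1

/-- For the field R y = P y, i_R β = 0 and dβ = 0 give L_R β = 0. The flow of R scales the range of
P, so the pullback of β by y ↦ y - P y + t • P y does not depend on t > 0. Continuity at t = 0 then
equates the values at t = 1 and t = 0. -/
theorem eq_pullback_of_closed_of_radial {β : E → E [⋀^Fin 2]→L[ℝ] ℝ} {B : Set E} (hB : IsOpen B)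
    (hβ : DifferentiableOn ℝ β B) (hd : ∀ y ∈ B, extDeriv β y = 0) (P : E →L[ℝ] E)
    (hP : P ∘L P = P) (hker : ∀ y ∈ B, ∀ w, bil (β y) (P y) w = 0)
    (hstar : ∀ y ∈ B, ∀ t ∈ Set.Icc (0 : ℝ) 1, y - P y + t • P y ∈ B) {p : E} (hp : p ∈ B)
    (v w : E) : bil (β p) v w = bil (β (p - P p)) (v - P v) (w - P w) := by
  have hPP : ∀ x, P (P x) = P x := fun x => DFunLike.congr_fun hP x
  have hβd : ∀ y ∈ B, HasFDerivAt β (fderiv ℝ β y) y := fun y hy =>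
    (hβ.differentiableAt (hB.mem_nhds hy)).hasFDerivAt
  -- the derivative of the equation `i_R β = 0`
  have hker' : ∀ y ∈ B, ∀ h w, bil (fderiv ℝ β y h) (P y) w + bil (β y) (P h) w = 0 := by
    intro y hy h w
    have hc : HasDerivAt (fun t : ℝ => y + t • h) h 0 := by
      simpa using ((hasDerivAt_id (0 : ℝ)).smul_const h).const_add y
    have hy' : HasFDerivAt β (fderiv ℝ β y) (y + (0 : ℝ) • h) := by simpa using hβd y hy
    have h1 := (hasDerivAt_bil hy' hc (P y) w).add
      ((hasDerivAt_id (0 : ℝ)).mul (hasDerivAt_bil hy' hc (P h) w))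
    have h2 := h1.unique ((hasDerivAt_const (0 : ℝ) (0 : ℝ)).congr_of_eventuallyEq ?_)
    · simpa using h2
    · have hcont : Filter.Tendsto (fun t : ℝ => y + t • h) (𝓝 0) (𝓝 y) := by
        simpa using hc.continuousAt.tendsto
      filter_upwards [hcont (hB.mem_nhds hy)] with t ht
      have := hker _ ht w
      simpa using this
  set y : ℝ → E := fun t => p - P p + t • P p with hy
  have hyB : ∀ t ∈ Set.Icc (0 : ℝ) 1, y t ∈ B := fun t ht => hstar p hp t ht
  have hPy : ∀ t, P (y t) = t • P p := fun t => by simp [hy, hPP]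
  have hyd : ∀ t, HasDerivAt y (P p) t := fun t => by
    have := ((hasDerivAt_id t).smul_const (P p)).const_add (p - P p)
    rwa [one_smul] at this
  set v0 := v - P v with hv0
  set w0 := w - P w with hw0
  have hPv0 : P v0 = 0 := by simp [hv0, hPP]
  have hPw0 : P w0 = 0 := by simp [hw0, hPP]
  -- This is L_R β = 0 on the ray, where R = t • P p; the factor t comes from R.
  have hlie : ∀ t ∈ Set.Icc (0 : ℝ) 1, ∀ a b, t * bil (fderiv ℝ β (y t) (P p)) a b =
      -bil (β (y t)) (P a) b - bil (β (y t)) a (P b) := by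
    intro t ht a b
    have hB' := hyB t ht
    have h0 : extDeriv β (y t) ![P p, a, b] = 0 := by rw [hd _ hB']; rfl
    rw [extDeriv_apply_three (hβd _ hB').differentiableAt] at h0
    have h1 := hker' _ hB' a b
    have h2 := hker' _ hB' b a
    rw [hPy, map_smul] at h1 h2
    simp only [smul_apply, smul_eq_mul] at h1 h2
    have h3 := bil_swap (β (y t)) (P b) a
    linear_combination t * h0 + h1 - h2 + h3
  -- g t is β (y t) evaluated on (v0 + t • P v, w0 + t • P w), expanded in powers of t.
  set g : ℝ → ℝ := fun t => bil (β (y t)) v0 w0 + t * (bil (β (y t)) (P v) w0 +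
    bil (β (y t)) v0 (P w)) + t ^ 2 * bil (β (y t)) (P v) (P w) with hg
  have hbd : ∀ t ∈ Set.Icc (0 : ℝ) 1, ∀ a b, HasDerivAt (fun t => bil (β (y t)) a b)
      (bil (fderiv ℝ β (y t) (P p)) a b) t := by
    intro t ht a b
    exact hasDerivAt_bil (hβd _ (hyB t ht)) (hyd t) a b
  -- `hlie` can be divided by t only when t > 0. This suffices: the mean value theorem evaluates g'
  -- at an interior point and needs only continuity at 0.
  have hgd : ∀ t ∈ Set.Icc (0 : ℝ) 1, ∃ g', HasDerivAt g g' t ∧ (0 < t → g' = 0) := by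
    intro t ht
    refine ⟨_, ((hbd t ht v0 w0).add ((hasDerivAt_id t).mul ((hbd t ht (P v) w0).add
      (hbd t ht v0 (P w))))).add (((hasDerivAt_id t).pow 2).mul (hbd t ht (P v) (P w))), ?_⟩
    intro ht0
    have h1 := hlie t ht v0 w0
    have h2 := hlie t ht (P v) w0
    have h3 := hlie t ht v0 (P w)
    have h4 := hlie t ht (P v) (P w)
    simp only [hPv0, hPw0, hPP, map_zero, zero_apply, neg_zero, sub_zero,
      zero_sub] at h1 h2 h3 h4
    have h5 : bil (fderiv ℝ β (y t) (P p)) v0 w0 = 0 :=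
      (mul_eq_zero.1 h1).resolve_left ht0.ne'
    simp only [id, Pi.add_apply, Pi.pow_apply]
    simp
    linear_combination h5 + h2 + h3 + t * h4
  obtain ⟨c, hc, hc'⟩ := exists_deriv_eq_slope g zero_lt_one
    (fun t ht => (hgd t ht).choose_spec.1.continuousAt.continuousWithinAt)
    (fun t ht => (hgd t ⟨ht.1.le, ht.2.le⟩).choose_spec.1.differentiableAt.differentiableWithinAt)
  obtain ⟨g', hg', hg'0⟩ := hgd c ⟨hc.1.le, hc.2.le⟩
  rw [hg'.deriv, hg'0 hc.1] at hc'
  have h01 : g 1 = g 0 := by linarith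
  have hy1 : y 1 = p := by simp [hy]
  have hy0 : y 0 = p - P p := by simp [hy]
  simp only [hg, hy1, hy0] at h01
  have hv : v = v0 + P v := by simp [hv0]
  have hw : w = w0 + P w := by simp [hw0]
  conv_lhs => rw [hv, hw]
  simp only [map_add, add_apply]
  linear_combination h01

end FlatForms

/-! ### Normal form of a closed form whose kernel has smooth sections. -/

section NormalForm

/-- A cutoff makes the kernel sections global, as the flow equation on C(I, E) requires. -/
theorem exists_contDiff_eventuallyEq {E G : Type*} [NormedAddCommGroup E] [NormedSpace ℝ E]
    [FiniteDimensional ℝ E] [NormedAddCommGroup G] [NormedSpace ℝ G] {f : E → G} {V : Set E}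
    {a : E} (hV : IsOpen V) (ha : a ∈ V) (hf : ContDiffOn ℝ ∞ f V) :
    ∃ g : E → G, ContDiff ℝ ∞ g ∧ g =ᶠ[𝓝 a] f := by
  obtain ⟨ε, hε, hball⟩ := Metric.isOpen_iff.1 hV a ha
  let χ : ContDiffBump a := ⟨ε / 4, ε / 2, by positivity, by linarith⟩
  refine ⟨fun x => χ x • f x, contDiff_iff_contDiffAt.2 fun x => ?_, ?_⟩
  · by_cases hx : x ∈ V
    · exact χ.contDiff.contDiffAt.smul (hf.contDiffAt (hV.mem_nhds hx))
    · have hx' : x ∉ tsupport χ := by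
        rw [χ.tsupport_eq]
        exact fun h => hx (hball (lt_of_le_of_lt h (by change ε / 2 < ε; linarith)))
      refine (contDiffAt_const (c := (0 : G))).congr_of_eventuallyEq ?_
      filter_upwards [notMem_tsupport_iff_eventuallyEq.1 hx'] with z hz
      simp [hz]
  · filter_upwards [χ.eventuallyEq_one] with z hz
    simp [hz]

variable {E : Type*} [NormedAddCommGroup E] [InnerProductSpace ℝ E] [FiniteDimensional ℝ E]

theorem norm_sub_starProjection_le (K : Submodule ℝ E) (p : E) :
    ‖p - K.starProjection p‖ ≤ ‖p‖ := by
  rw [← Submodule.starProjection_orthogonal_val]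
  exact Kᗮ.norm_starProjection_apply_le p

/-- Around a point where its kernel is spanned by smooth sections of the kernel, a closed `2`-form
is in suitable coordinates the pullback of a nondegenerate form on the orthogonal complement
of the kernel. -/
theorem exists_normalForm {V : Set E} (hV : IsOpen V) (h0 : (0 : E) ∈ V)
    {β : E → E [⋀^Fin 2]→L[ℝ] ℝ} (hβ : ContDiffOn ℝ ∞ β V) (hd : ∀ y ∈ V, extDeriv β y = 0)
    {X : E → E →L[ℝ] E} (hX : ContDiffOn ℝ ∞ X V)
    (hXker : ∀ y ∈ V, ∀ v w, bil (β y) (X y v) w = 0) (K : Submodule ℝ E)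
    (hX0 : X 0 = K.starProjection) (hK : ∀ v, v ∈ K ↔ ∀ w, bil (β 0) v w = 0) :
    ∃ r > 0, ∃ Φ : OpenPartialHomeomorph E E, Φ.source = Metric.ball 0 r ∧ Φ.target ⊆ V ∧
      Φ 0 = 0 ∧ ContDiffOn ℝ ∞ Φ Φ.source ∧ ContDiffOn ℝ ∞ Φ.symm Φ.target ∧
      (∀ p ∈ Metric.ball (0 : E) r, ∀ v w, bil (flatPullback Φ β p) v w =
        bil (flatPullback Φ β (p - K.starProjection p)) (v - K.starProjection v)
          (w - K.starProjection w)) ∧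
      ∀ p ∈ Metric.ball (0 : E) r, ∀ v, v ∈ K ↔ ∀ w, bil (flatPullback Φ β p) v w = 0 := by
  set P := K.starProjection with hPdef
  have hP : P ∘L P = P := K.isIdempotentElem_starProjection
  have hPmem : ∀ v, v ∈ K ↔ P v = v := fun v => K.starProjection_eq_self_iff.symm
  obtain ⟨Y, hY, hYX⟩ := exists_contDiff_eventuallyEq hV h0 hX
  obtain ⟨Φ, hΦ0, hΦ00, hΦs, hΦs', hΦd, hΦr⟩ := exists_flowBox Y hY P hP
    (hYX.self_of_nhds.trans hX0)
  obtain ⟨V', hV'sub, hV'o, hV'0⟩ := mem_nhds_iff.1 (Filter.inter_mem (hV.mem_nhds h0) hYX)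
  set s := Φ.source ∩ Φ ⁻¹' V' with hs
  have hso : IsOpen s := Φ.isOpen_inter_preimage hV'o
  have h0s : (0 : E) ∈ s := ⟨hΦ0, by change Φ 0 ∈ V'; rwa [hΦ00]⟩
  set β' := flatPullback Φ β with hβ'
  have hmaps : Set.MapsTo Φ s V := fun x hx => (hV'sub hx.2).1
  have hΦss : ContDiffOn ℝ ∞ Φ s := hΦs.mono Set.inter_subset_left
  have hβ's : ContDiffOn ℝ ∞ β' s := contDiffOn_flatPullback hso hβ hΦss hmaps
  have hβ'd : ∀ y ∈ s, extDeriv β' y = 0 := extDeriv_flatPullback hso hV hβ hΦss hmaps hd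
  have hrad : ∀ y ∈ s, ∀ w, bil (β' y) (P y) w = 0 := by
    intro y hy w
    have hYy : Y (Φ y) = X (Φ y) := (hV'sub hy.2).2
    rw [hβ', bil_flatPullback, hΦr y hy.1, hYy]
    exact hXker _ (hmaps hy) _ _
  -- nondegeneracy on the complement is an open condition
  have hNc : ContinuousAt (fun p => bil (β' p)) 0 :=
    continuousAt_bil (hβ's.continuousOn.continuousAt (hso.mem_nhds h0s))
  have hβ'0 : ∀ v w, bil (β' 0) v w = bil (β 0) v w := by
    intro v w
    rw [hβ', bil_flatPullback, hΦ00, hΦd.fderiv]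
    rfl
  -- The inner product on K compensates the kernel of β' at 0: testing against P v gives P v = 0,
  -- and then v lies in K. At nearby p the same injectivity prevents the kernel from being larger
  -- than K.
  have hinj : Function.Injective fun v => bil (β' 0) v + (innerSL ℝ ∘L P) v := by
    change Function.Injective (bil (β' 0) + innerSL ℝ ∘L P).toLinearMap.toAddMonoidHom
    rw [injective_iff_map_eq_zero]
    intro v hv
    have h1 : ∀ w, bil (β 0) v w + inner ℝ (P v) w = 0 := by
      intro w
      have := DFunLike.congr_fun hv w
      rw [← hβ'0]
      exact this
    have hPP : P (P v) = P v := DFunLike.congr_fun hP v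
    have hPv : P v = 0 := by
      have h2 := h1 (P v)
      rw [bil_swap, (hK (P v)).1 ((hPmem _).2 hPP) v, neg_zero, zero_add] at h2
      exact inner_self_eq_zero.1 h2
    have hvK : v ∈ K := (hK v).2 fun w => by simpa [hPv] using h1 w
    rw [← (hPmem v).1 hvK, hPv]
  have hNinj := eventually_injective_add (A := E) (B := E →L[ℝ] ℝ) hNc hinj
  obtain ⟨r, hr, hrs⟩ := Metric.eventually_nhds_iff_ball.1 (Filter.Eventually.and
    (hso.mem_nhds h0s) hNinj)
  have hball_s : Metric.ball 0 r ⊆ s := fun x hx => (hrs x hx).1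
  have hbS : Metric.ball 0 r ⊆ Φ.source := hball_s.trans Set.inter_subset_left
  have hstar : ∀ y ∈ Metric.ball (0 : E) r, ∀ t ∈ Set.Icc (0 : ℝ) 1,
      y - P y + t • P y ∈ Metric.ball (0 : E) r := by
    intro y hy t ht
    have h1 : y - P y ∈ Metric.ball (0 : E) r := by
      rw [mem_ball_zero_iff] at hy ⊢
      exact (norm_sub_starProjection_le K y).trans_lt hy
    have := (convex_ball (0 : E) r) h1 hy (sub_nonneg.2 ht.2) ht.1 (by ring)
    convert! this using 1
    module
  have hinv : ∀ p ∈ Metric.ball (0 : E) r, ∀ v w, bil (β' p) v w =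
      bil (β' (p - P p)) (v - P v) (w - P w) := fun p hp v w =>
    eq_pullback_of_closed_of_radial Metric.isOpen_ball
      ((hβ's.mono hball_s).differentiableOn (by simp)) (fun y hy => hβ'd y (hball_s hy)) P hP
      (fun y hy => hrad y (hball_s hy)) hstar hp v w
  refine ⟨r, hr, Φ.restrOpen (Metric.ball 0 r) Metric.isOpen_ball, ?_, ?_, hΦ00, ?_, ?_, hinv, ?_⟩
  · exact Set.inter_eq_right.2 hbS
  · intro x hx
    have h1 := (Φ.restrOpen (Metric.ball 0 r) Metric.isOpen_ball).map_target hx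
    have h2 := hmaps (hball_s h1.2)
    rwa [show Φ ((Φ.restrOpen (Metric.ball 0 r) Metric.isOpen_ball).symm x) = x from
      (Φ.restrOpen (Metric.ball 0 r) Metric.isOpen_ball).right_inv hx] at h2
  · exact hΦs.mono Set.inter_subset_left
  · exact hΦs'.mono (fun x hx => hx.1)
  · intro p hp v
    change v ∈ K ↔ ∀ w, bil (β' p) v w = 0
    constructor
    · intro hv w
      rw [hinv p hp, (hPmem v).1 hv]
      simp
    · intro h
      have hPP : P (P v) = P v := DFunLike.congr_fun hP v
      have hz : v - P v = 0 := by
        refine (hrs p hp).2 ?_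
        ext w
        have h1 : bil (β' p) (v - P v) w = 0 := by
          rw [map_sub, sub_apply, h w, hinv p hp (P v), hPP]
          simp
        have h2 : (innerSL ℝ ∘L P) (v - P v) w = 0 := by
          change inner ℝ (P (v - P v)) w = 0
          rw [map_sub P, hPP, sub_self, inner_zero_left]
        change bil (β' p) (v - P v) w + (innerSL ℝ ∘L P) (v - P v) w =
          bil (β' p) 0 w + (innerSL ℝ ∘L P) 0 w
        rw [h1, h2]
        simp
      rw [hPmem]
      exact (sub_eq_zero.1 hz).symm

end NormalForm

/-! ### Smooth sections of the kernel along a coisotropic immersion. -/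

section KernelSections

theorem isInvertible_of_injective {A B : Type*} [NormedAddCommGroup A]
    [NormedSpace ℝ A] [FiniteDimensional ℝ A] [NormedAddCommGroup B] [NormedSpace ℝ B]
    [FiniteDimensional ℝ B] (h : Module.finrank ℝ A = Module.finrank ℝ B) (f : A →L[ℝ] B)
    (hf : Function.Injective f) : f.IsInvertible :=
  ⟨(LinearEquiv.ofInjectiveOfFinrankEq f.toLinearMap hf h).toContinuousLinearEquiv, by ext; rfl⟩

theorem contDiffOn_inverse {A B C : Type*} [NormedAddCommGroup A] [NormedSpace ℝ A]
    [CompleteSpace A] [NormedAddCommGroup B] [NormedSpace ℝ B] [NormedAddCommGroup C]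
    [NormedSpace ℝ C] {f : C → A →L[ℝ] B} {s : Set C} (hf : ContDiffOn ℝ ∞ f s)
    (hinv : ∀ y ∈ s, (f y).IsInvertible) : ContDiffOn ℝ ∞ (fun y => (f y).inverse) s :=
  fun y hy => (hinv y hy).contDiffAt_map_inverse.comp_contDiffWithinAt y (hf y hy)

theorem finrank_continuousDual {F : Type*} [NormedAddCommGroup F] [NormedSpace ℝ F]
    [FiniteDimensional ℝ F] : Module.finrank ℝ F = Module.finrank ℝ (F →L[ℝ] ℝ) := by
  rw [← (LinearMap.toContinuousLinearMap (𝕜 := ℝ) (E := F) (F' := ℝ)).finrank_eq]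
  exact (Subspace.dual_finrank_eq (K := ℝ) (V := F)).symm

variable {E F : Type*} [NormedAddCommGroup E] [NormedSpace ℝ E] [FiniteDimensional ℝ E]
  [NormedAddCommGroup F] [NormedSpace ℝ F] [FiniteDimensional ℝ F]

/-- Along a coisotropic immersion, the vectors in the kernel of the pulled back form at a point
extend to smooth sections of the kernel. -/
theorem exists_kernel_sections {V : Set E} (hV : IsOpen V) (h0 : (0 : E) ∈ V) {g : E → F}
    (hg : ContDiffOn ℝ ∞ g V) {η : F → F [⋀^Fin 2]→L[ℝ] ℝ} {T : Set F} (hη : ContDiffOn ℝ ∞ η T)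
    (hgT : Set.MapsTo g V T) (hnd : ∀ z ∈ T, ∀ v, (∀ w, bil (η z) v w = 0) → v = 0)
    (hinj : Function.Injective (fderiv ℝ g 0))
    (hco : ∀ y ∈ V, ∀ v, (∀ w, bil (η (g y)) v (fderiv ℝ g y w) = 0) → ∃ w, fderiv ℝ g y w = v)
    (P : E →L[ℝ] E) (hP : ∀ v w, bil (flatPullback g η 0) (P v) w = 0) :
    ∃ V' ⊆ V, IsOpen V' ∧ (0 : E) ∈ V' ∧ ∃ X : E → E →L[ℝ] E, ContDiffOn ℝ ∞ X V' ∧ X 0 = P ∧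
      ∀ y ∈ V', ∀ v w, bil (flatPullback g η y) (X y v) w = 0 := by
  obtain ⟨L, hL⟩ := exists_continuousLinearMap_leftInverse (fderiv ℝ g 0) hinj
  have hdg : ContDiffOn ℝ ∞ (fderiv ℝ g) V := hg.fderiv_of_isOpen hV (by simp)
  have hLdg : ContDiffOn ℝ ∞ (fun y => L ∘L fderiv ℝ g y) V := contDiffOn_const.clm_comp hdg
  set V' : Set E := V ∩ (fun y => L ∘L fderiv ℝ g y) ⁻¹'
    Set.range ((↑) : (E ≃L[ℝ] E) → E →L[ℝ] E) with hV'
  have hV'o : IsOpen V' := hLdg.continuousOn.isOpen_inter_preimage hV ContinuousLinearEquiv.isOpen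
  have hL0 : L ∘L fderiv ℝ g 0 = .id ℝ E := by ext v; exact hL v
  have h0' : (0 : E) ∈ V' := ⟨h0, ContinuousLinearEquiv.refl ℝ E, hL0.symm⟩
  have hsub : V' ⊆ V := Set.inter_subset_left
  have hinvV : ∀ y ∈ V', (L ∘L fderiv ℝ g y).IsInvertible := fun y hy => hy.2
  -- A left inverse of dg at 0, corrected to a smooth family of left inverses of dg at y.
  let R : E → F →L[ℝ] E := fun y => (L ∘L fderiv ℝ g y).inverse ∘L L
  have hRs : ContDiffOn ℝ ∞ R V' :=
    (contDiffOn_inverse (hLdg.mono hsub) hinvV).clm_comp contDiffOn_const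
  have hR : ∀ y ∈ V', ∀ v, R y (fderiv ℝ g y v) = v := by
    intro y hy v
    obtain ⟨e, he⟩ := hinvV y hy
    change (L ∘L fderiv ℝ g y).inverse ((L ∘L fderiv ℝ g y) v) = v
    rw [← he, ContinuousLinearMap.inverse_equiv]
    exact e.symm_apply_apply v
  have hωs : ContDiffOn ℝ ∞ (fun y => bil (η (g y))) V' :=
    contDiff_bil.comp_contDiffOn (hη.comp (hg.mono hsub) (hgT.mono_left hsub))
  have hωinv : ∀ y ∈ V', (bil (η (g y))).IsInvertible := fun y hy =>
    isInvertible_of_injective (A := F) (B := F →L[ℝ] ℝ) finrank_continuousDual _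
      ((injective_iff_map_eq_zero _).2 fun v hv => hnd _ (hgT (hsub hy)) v fun w => by
        rw [hv]; rfl)
  let J : E → (F →L[ℝ] ℝ) →L[ℝ] F := fun y => (bil (η (g y))).inverse
  have hJs : ContDiffOn ℝ ∞ J V' := contDiffOn_inverse (A := F) (B := F →L[ℝ] ℝ) hωs hωinv
  have hJ : ∀ y ∈ V', ∀ l, bil (η (g y)) (J y l) = l := by
    intro y hy l
    obtain ⟨e, he⟩ := hωinv y hy
    change bil (η (g y)) ((bil (η (g y))).inverse l) = l
    rw [← he, ContinuousLinearMap.inverse_equiv]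
    exact e.apply_symm_apply l
  have hJ' : ∀ y ∈ V', ∀ v, J y (bil (η (g y)) v) = v := by
    intro y hy v
    obtain ⟨e, he⟩ := hωinv y hy
    change (bil (η (g y))).inverse (bil (η (g y)) v) = v
    rw [← he, ContinuousLinearMap.inverse_equiv]
    exact e.symm_apply_apply v
  let S : E → F →L[ℝ] F := fun y => .id ℝ F - fderiv ℝ g y ∘L R y
  have hSs : ContDiffOn ℝ ∞ S V' := contDiffOn_const.sub ((hdg.mono hsub).clm_comp hRs)
  have hS : ∀ y ∈ V', ∀ w, S y (fderiv ℝ g y w) = 0 := by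
    intro y hy w
    change fderiv ℝ g y w - fderiv ℝ g y (R y (fderiv ℝ g y w)) = 0
    rw [hR y hy, sub_self]
  let Λ : E →L[ℝ] F →L[ℝ] ℝ := bil (η (g 0)) ∘L fderiv ℝ g 0 ∘L P
  -- S y kills the image of dg, so Λ v ∘ S y annihilates the tangent space. J y turns this covector
  -- into a skew-orthogonal vector, tangent by coisotropy, and R y reads it in E. At 0, Λ v already
  -- annihilates the tangent space, so S 0 does not change it and X 0 = P.
  let X : E → E →L[ℝ] E := fun y =>
    R y ∘L J y ∘L (ContinuousLinearMap.compL ℝ F F ℝ).flip (S y) ∘L Λ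
  have hX : ∀ y v, X y v = R y (J y (Λ v ∘L S y)) := fun y v => rfl
  refine ⟨V', hsub, hV'o, h0', X, ?_, ?_, ?_⟩
  · have h1 : ContDiffOn ℝ ∞ (fun y => (ContinuousLinearMap.compL ℝ F F ℝ).flip (S y)) V' := by
      fun_prop
    exact hRs.clm_comp (hJs.clm_comp (h1.clm_comp contDiffOn_const))
  · ext1 v
    have h1 : Λ v ∘L S 0 = bil (η (g 0)) (fderiv ℝ g 0 (P v)) := by
      ext w
      change Λ v (w - fderiv ℝ g 0 (R 0 w)) = _
      rw [map_sub]
      have : Λ v (fderiv ℝ g 0 (R 0 w)) = 0 := by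
        have := hP v (R 0 w)
        rwa [bil_flatPullback] at this
      rw [this, sub_zero]
      rfl
    rw [hX, h1, hJ' 0 h0', hR 0 h0']
  · intro y hy v w
    have h1 : ∀ w, bil (η (g y)) (J y (Λ v ∘L S y)) (fderiv ℝ g y w) = 0 := by
      intro w
      rw [hJ y hy]
      change Λ v (S y (fderiv ℝ g y w)) = 0
      rw [hS y hy, map_zero]
    obtain ⟨u, hu⟩ := hco y (hsub hy) _ h1
    rw [bil_flatPullback, hX, ← hu, hR y hy, hu]
    exact h1 w

end KernelSections

/-! ### Differentials between model spaces and their chain rule. -/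

section TangentMaps

variable {E₁ H₁ E₂ H₂ E₃ H₃ : Type*} [NormedAddCommGroup E₁] [NormedSpace ℝ E₁]
  [TopologicalSpace H₁] [NormedAddCommGroup E₂] [NormedSpace ℝ E₂] [TopologicalSpace H₂]
  [NormedAddCommGroup E₃] [NormedSpace ℝ E₃] [TopologicalSpace H₃]
  (I₁ : ModelWithCorners ℝ E₁ H₁) (I₂ : ModelWithCorners ℝ E₂ H₂) (I₃ : ModelWithCorners ℝ E₃ H₃)
  {A : Type*} [TopologicalSpace A] [ChartedSpace H₁ A]
  {B : Type*} [TopologicalSpace B] [ChartedSpace H₂ B]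
  {C : Type*} [TopologicalSpace C] [ChartedSpace H₃ C]

/-- The differential of a map, as a linear map between the model vector spaces. -/
def tmap (g : A → B) (x : A) : E₁ →L[ℝ] E₂ := mfderiv I₁ I₂ g x

theorem tmap_comp {g : B → C} {h : A → B} (x : A) (hg : MDifferentiableAt I₂ I₃ g (h x))
    (hh : MDifferentiableAt I₁ I₂ h x) :
    tmap I₁ I₃ (g ∘ h) x = tmap I₂ I₃ g (h x) ∘L tmap I₁ I₂ h x :=
  mfderiv_comp x hg hh

theorem tmap_comp_apply {g : B → C} {h : A → B} (x : A) (hg : MDifferentiableAt I₂ I₃ g (h x))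
    (hh : MDifferentiableAt I₁ I₂ h x) (v : E₁) :
    tmap I₁ I₃ (g ∘ h) x v = tmap I₂ I₃ g (h x) (tmap I₁ I₂ h x v) := by
  rw [tmap_comp I₁ I₂ I₃ x hg hh]
  rfl

theorem tmap_congr {g h : A → B} {x : A} (hgh : g =ᶠ[𝓝 x] h) :
    tmap I₁ I₂ g x = tmap I₁ I₂ h x := by
  have h1 := hgh.mfderiv_eq (I := I₁) (I' := I₂)
  exact h1

theorem tmap_eq_fderiv (g : E₁ → E₂) (x : E₁) : tmap 𝓘(ℝ, E₁) 𝓘(ℝ, E₂) g x = fderiv ℝ g x :=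
  mfderiv_eq_fderiv

variable {I₁ I₂} in
theorem tmap_symm_apply_tmap {e : OpenPartialHomeomorph A B} (he : e.MDifferentiable I₁ I₂) {x : A}
    (hx : x ∈ e.source) (v : E₁) : tmap I₂ I₁ e.symm (e x) (tmap I₁ I₂ e x v) = v :=
  DFunLike.congr_fun (he.symm_comp_deriv hx) v

variable {I₁ I₂} in
theorem tmap_apply_tmap_symm {e : OpenPartialHomeomorph A B} (he : e.MDifferentiable I₁ I₂) {y : B}
    (hy : y ∈ e.target) (v : E₂) : tmap I₁ I₂ e (e.symm y) (tmap I₂ I₁ e.symm y v) = v :=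
  DFunLike.congr_fun (he.comp_symm_deriv hy) v

end TangentMaps

/-! ### Forms, coisotropy and immersions in terms of bilinear forms. -/

section Bridge

variable {k l : ℕ}
  {M : Type*} [TopologicalSpace M] [ChartedSpace (EuclideanSpace ℝ (Fin k)) M]
  {N : Type*} [TopologicalSpace N] [ChartedSpace (EuclideanSpace ℝ (Fin l)) N]

/-- The bilinear form on the model space given by a `2`-form at a point. -/
def bilAt (Ω : TwoForm k M) (x : M) :
    EuclideanSpace ℝ (Fin k) →L[ℝ] EuclideanSpace ℝ (Fin k) →L[ℝ] ℝ :=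
  bil (Ω x : EuclideanSpace ℝ (Fin k) [⋀^Fin 2]→L[ℝ] ℝ)

theorem bilAt_apply (Ω : TwoForm k M) (x : M) (v w : EuclideanSpace ℝ (Fin k)) :
    bilAt Ω x v w = (Ω x : EuclideanSpace ℝ (Fin k) [⋀^Fin 2]→L[ℝ] ℝ) ![v, w] :=
  bil_apply _ _ _

theorem bilAt_smul (Ω : TwoForm k M) (f : M → ℝ) (x : M) (v w : EuclideanSpace ℝ (Fin k)) :
    bilAt (fun y => f y • Ω y : TwoForm k M) x v w = f x * bilAt Ω x v w := by
  rw [bilAt_apply, bilAt_apply]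
  rfl

theorem bilAt_pullback (g : M → N) (τ : TwoForm l N) (x : M) (v w : EuclideanSpace ℝ (Fin k)) :
    bilAt (pullback g τ) x v w =
      bilAt τ (g x) (tmap (𝓡 k) (𝓡 l) g x v) (tmap (𝓡 k) (𝓡 l) g x w) :=
  bil_compContinuousLinearMap (E := EuclideanSpace ℝ (Fin k)) (F := EuclideanSpace ℝ (Fin l))
    (τ (g x)) (tmap (𝓡 k) (𝓡 l) g x) v w

theorem bil_chartRep (Ω : TwoForm k M) (e : OpenPartialHomeomorph M (EuclideanSpace ℝ (Fin k)))
    (y v w : EuclideanSpace ℝ (Fin k)) : bil (chartRep Ω e y) v w =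
      bilAt Ω (e.symm y) (tmap (𝓡 k) (𝓡 k) e.symm y v) (tmap (𝓡 k) (𝓡 k) e.symm y w) :=
  bil_compContinuousLinearMap (E := EuclideanSpace ℝ (Fin k)) (F := EuclideanSpace ℝ (Fin k))
    (Ω (e.symm y)) (tmap (𝓡 k) (𝓡 k) e.symm y) v w

theorem twoForm_ext {Ω τ : TwoForm k M} {x : M} (h : ∀ v w, bilAt Ω x v w = bilAt τ x v w) :
    Ω x = τ x :=
  bil_injective (E := EuclideanSpace ℝ (Fin k)) (by ext v w; exact h v w)

theorem isNondegenerateOn_iff (Ω : TwoForm k M) (U : Set M) : IsNondegenerateOn Ω U ↔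
    ∀ x ∈ U, ∀ v, (∀ w, bilAt Ω x v w = 0) → v = 0 := by
  simp only [bilAt_apply]
  rfl

theorem mem_charDist_iff (ι : M → N) (Ω : TwoForm l N) (x : M) (v : EuclideanSpace ℝ (Fin k)) :
    v ∈ (charDist k ι Ω x : Submodule ℝ (EuclideanSpace ℝ (Fin k))) ↔
    ∀ w, bilAt Ω (ι x) (tmap (𝓡 k) (𝓡 l) ι x v) (tmap (𝓡 k) (𝓡 l) ι x w) = 0 := by
  simp only [bilAt_apply]
  rfl

theorem isCoisotropic_iff (ι : M → N) (Ω : TwoForm l N) : IsCoisotropic k ι Ω ↔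
    ∀ x v, (∀ w, bilAt Ω (ι x) v (tmap (𝓡 k) (𝓡 l) ι x w) = 0) →
      ∃ w, tmap (𝓡 k) (𝓡 l) ι x w = v := by
  simp only [bilAt_apply]
  rfl

/-- The differential of an immersion is injective. -/
theorem injective_tmap_of_isImmersion [IsManifold (𝓡 k) ∞ M] [IsManifold (𝓡 l) ∞ N] {ι : M → N}
    (hι : Manifold.IsImmersion (𝓡 k) (𝓡 l) ∞ ι) (x : M) :
    Function.Injective (tmap (𝓡 k) (𝓡 l) ι x) := by
  have h := hι.isImmersionAt x
  set φ := h.domChart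
  set ψ := h.codChart
  have hφ := h.domChart_mem_maximalAtlas
  have hψ := h.codChart_mem_maximalAtlas
  have hx : x ∈ φ.source := h.mem_domChart_source
  have hιx : ι x ∈ ψ.source := h.mem_codChart_source
  let j : EuclideanSpace ℝ (Fin k) →L[ℝ] EuclideanSpace ℝ (Fin l) :=
    h.equiv.toContinuousLinearMap ∘L ContinuousLinearMap.inl ℝ _ _
  have hψd : MDifferentiableAt (𝓡 l) (𝓡 l) ψ (ι x) :=
    (contMDiffAt_of_mem_maximalAtlas hψ hιx).mdifferentiableAt (by simp)
  have hφd : MDifferentiableAt (𝓡 k) (𝓡 k) φ x :=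
    (contMDiffAt_of_mem_maximalAtlas hφ hx).mdifferentiableAt (by simp)
  have hιd : MDifferentiableAt (𝓡 k) (𝓡 l) ι x := h.contMDiffAt.mdifferentiableAt (by simp)
  have heq : ψ ∘ ι =ᶠ[𝓝 x] j ∘ φ := by
    filter_upwards [φ.open_source.mem_nhds hx] with z hz
    have hz' : φ z ∈ (φ.extend (𝓡 k)).target := by simpa using φ.map_source hz
    have h1 := h.writtenInCharts hz'
    have h2 : (φ.extend (𝓡 k)).symm (φ z) = z := φ.left_inv hz
    simp only [Function.comp_apply] at h1
    rw [h2] at h1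
    exact h1
  have hjd : MDifferentiableAt (𝓡 k) (𝓡 l) j (φ x) := j.differentiableAt.mdifferentiableAt
  have h2 := tmap_congr (𝓡 k) (𝓡 l) heq
  rw [tmap_comp (𝓡 k) (𝓡 l) (𝓡 l) x hψd hιd, tmap_comp (𝓡 k) (𝓡 k) (𝓡 l) x hjd hφd,
    tmap_eq_fderiv, j.fderiv] at h2
  rw [injective_iff_map_eq_zero]
  intro v hv
  have h3 := DFunLike.congr_fun h2 v
  simp only [ContinuousLinearMap.comp_apply, hv, map_zero] at h3
  have h4 : tmap (𝓡 k) (𝓡 k) φ x v = 0 := by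
    have h5 := (map_eq_zero_iff h.equiv h.equiv.injective).1 h3.symm
    exact congrArg Prod.fst h5
  have hφm : φ.MDifferentiable (𝓡 k) (𝓡 k) :=
    ⟨(contMDiffOn_of_mem_maximalAtlas hφ).mdifferentiableOn (by simp),
      (contMDiffOn_symm_of_mem_maximalAtlas hφ).mdifferentiableOn (by simp)⟩
  have h6 := tmap_symm_apply_tmap hφm hx v
  rwa [h4, map_zero, eq_comm] at h6

end Bridge

/-! ### The orthogonal complement as a standard Euclidean space. -/

section OrthogonalModel

variable {E : Type*} [NormedAddCommGroup E] [InnerProductSpace ℝ E] [FiniteDimensional ℝ E]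

/-- The orthogonal complement of a subspace, modelled on a standard Euclidean space. -/
structure OrthogonalModel (K : Submodule ℝ E) (m : ℕ) where
  /-- The orthogonal projection. -/
  proj : E →L[ℝ] EuclideanSpace ℝ (Fin m)
  /-- The inclusion of the complement. -/
  incl : EuclideanSpace ℝ (Fin m) →L[ℝ] E
  proj_incl : ∀ a, proj (incl a) = a
  incl_proj : ∀ v, incl (proj v) = v - K.starProjection v
  norm_incl : ∀ a, ‖incl a‖ = ‖a‖

/-- The orthogonal model given by an orthonormal basis of the complement. -/
def orthogonalModel (K : Submodule ℝ E) : OrthogonalModel K (Module.finrank ℝ Kᗮ) where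
  proj := (stdOrthonormalBasis ℝ Kᗮ).repr.toContinuousLinearEquiv.toContinuousLinearMap ∘L
    Kᗮ.orthogonalProjectionOnto
  incl := Kᗮ.subtypeL ∘L
    (stdOrthonormalBasis ℝ Kᗮ).repr.symm.toContinuousLinearEquiv.toContinuousLinearMap
  proj_incl a := by simp
  incl_proj v := by
    simp only [ContinuousLinearMap.comp_apply, ContinuousLinearEquiv.coe_coe,
      LinearIsometryEquiv.coe_toContinuousLinearEquiv, LinearIsometryEquiv.symm_apply_apply]
    exact K.starProjection_orthogonal_val v
  norm_incl a := (stdOrthonormalBasis ℝ Kᗮ).repr.symm.norm_map a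

namespace OrthogonalModel

variable {K : Submodule ℝ E} {m : ℕ} (o : OrthogonalModel K m)

theorem proj_eq_zero_iff (v : E) : o.proj v = 0 ↔ v ∈ K := by
  rw [← Submodule.starProjection_eq_self_iff (K := K)]
  constructor
  · intro h
    have := o.incl_proj v
    rw [h, map_zero, eq_comm, sub_eq_zero] at this
    exact this.symm
  · intro h
    have := o.proj_incl (o.proj v)
    rw [o.incl_proj, h, sub_self, map_zero] at this
    exact this.symm

theorem starProjection_incl (a : EuclideanSpace ℝ (Fin m)) :
    o.incl a - K.starProjection (o.incl a) = o.incl a := by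
  rw [← o.incl_proj, o.proj_incl]

theorem norm_proj_le (v : E) : ‖o.proj v‖ ≤ ‖v‖ := by
  rw [← o.norm_incl, o.incl_proj]
  exact norm_sub_starProjection_le K v

theorem isOpenMap_proj : IsOpenMap o.proj :=
  o.proj.isOpenMap fun a => ⟨o.incl a, o.proj_incl a⟩

theorem proj_mem_ball {r : ℝ} {v : E} (hv : v ∈ Metric.ball (0 : E) r) :
    o.proj v ∈ Metric.ball (0 : EuclideanSpace ℝ (Fin m)) r := by
  rw [mem_ball_zero_iff] at hv ⊢
  exact (o.norm_proj_le v).trans_lt hv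

theorem incl_mem_ball {r : ℝ} {a : EuclideanSpace ℝ (Fin m)} (ha : a ∈ Metric.ball 0 r) :
    o.incl a ∈ Metric.ball (0 : E) r := by
  rw [mem_ball_zero_iff] at ha ⊢
  rwa [o.norm_incl]

/-- The splitting of the space given by an orthogonal model. -/
def splitting : E ≃L[ℝ] EuclideanSpace ℝ (Fin m) × K :=
  ContinuousLinearEquiv.equivOfInverse (o.proj.prod K.orthogonalProjectionOnto)
    (o.incl ∘L ContinuousLinearMap.fst ℝ _ _ + K.subtypeL ∘L ContinuousLinearMap.snd ℝ _ _)
    (fun v => by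
      simp [o.incl_proj])
    (fun z => by
      obtain ⟨a, u⟩ := z
      have h1 : o.proj (u : E) = 0 := (o.proj_eq_zero_iff _).2 u.2
      have h2 : K.orthogonalProjectionOnto (o.incl a) = 0 := by
        have := o.starProjection_incl a
        rw [sub_eq_self] at this
        exact Subtype.ext this
      simp [o.proj_incl, h1, h2])

end OrthogonalModel

end OrthogonalModel

/-! ### Leaves as fibres of a linear projection. -/

section Leaves

theorem mdifferentiable_of_mem_maximalAtlas {d : ℕ} {Q : Type*} [TopologicalSpace Q]
    [ChartedSpace (EuclideanSpace ℝ (Fin d)) Q]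
    {κ : OpenPartialHomeomorph Q (EuclideanSpace ℝ (Fin d))}
    (hκ : κ ∈ IsManifold.maximalAtlas (𝓡 d) ∞ Q) : κ.MDifferentiable (𝓡 d) (𝓡 d) :=
  ⟨(contMDiffOn_of_mem_maximalAtlas hκ).mdifferentiableOn (by simp),
    (contMDiffOn_symm_of_mem_maximalAtlas hκ).mdifferentiableOn (by simp)⟩

variable {d m : ℕ} {Q : Type*} [TopologicalSpace Q] [ChartedSpace (EuclideanSpace ℝ (Fin d)) Q]

/-- In a global chart onto a ball in which a distribution is the kernel of a projection, the
leaves are the fibres of the projection. -/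
theorem leafSetoid_iff {κ : OpenPartialHomeomorph Q (EuclideanSpace ℝ (Fin d))}
    (hκ : κ ∈ IsManifold.maximalAtlas (𝓡 d) ∞ Q) (hs : κ.source = Set.univ) {r : ℝ}
    (ht : κ.target = Metric.ball 0 r)
    (p : EuclideanSpace ℝ (Fin d) →L[ℝ] EuclideanSpace ℝ (Fin m))
    (D : (x : Q) → Submodule ℝ (TangentSpace (𝓡 d) x))
    (hD : ∀ (x : Q) (v : EuclideanSpace ℝ (Fin d)),
      v ∈ (D x : Submodule ℝ (EuclideanSpace ℝ (Fin d))) ↔ p (tmap (𝓡 d) (𝓡 d) κ x v) = 0)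
    (x y : Q) : leafSetoid D x y ↔ p (κ x) = p (κ y) := by
  have hsrc : ∀ z, z ∈ κ.source := fun z => hs ▸ Set.mem_univ z
  have hκd := mdifferentiable_of_mem_maximalAtlas hκ
  constructor
  · intro h
    induction (h : Relation.EqvGen (JoinedAlong D) x y) with
    | rel a b hab =>
      obtain ⟨γ, hγ, rfl, rfl, hγD⟩ := hab
      have hγd : ∀ t, MDifferentiableAt 𝓘(ℝ, ℝ) (𝓡 d) γ t := fun t =>
        (hγ t).mdifferentiableAt (by simp)
      have hkγ : ∀ t, MDifferentiableAt 𝓘(ℝ, ℝ) (𝓡 d) (κ ∘ γ) t := fun t =>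
        (hκd.mdifferentiableAt (hsrc _)).comp t (hγd t)
      have hcd : ∀ t, HasDerivAt (fun t => p (κ (γ t))) 0 t := by
        intro t
        have h1 : DifferentiableAt ℝ (κ ∘ γ) t := (hkγ t).differentiableAt
        have h2 := p.hasFDerivAt.comp_hasDerivAt t h1.hasDerivAt
        have h3 : deriv (κ ∘ γ) t = tmap (𝓡 d) (𝓡 d) κ (γ t) (tmap 𝓘(ℝ, ℝ) (𝓡 d) γ t 1) := by
          rw [← tmap_comp_apply 𝓘(ℝ, ℝ) (𝓡 d) (𝓡 d) t (hκd.mdifferentiableAt (hsrc _)) (hγd t),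
            tmap_eq_fderiv]
          rfl
        have h4 : p (tmap (𝓡 d) (𝓡 d) κ (γ t) (tmap 𝓘(ℝ, ℝ) (𝓡 d) γ t 1)) = 0 :=
          (hD (γ t) _).1 (hγD t)
        rwa [h3, h4] at h2
      exact is_const_of_deriv_eq_zero (fun t => (hcd t).differentiableAt)
        (fun t => (hcd t).deriv) 0 1
    | refl a => rfl
    | symm a b _ ih => exact ih.symm
    | trans a b c _ _ ih1 ih2 => exact ih1.trans ih2
  · intro h
    refine Relation.EqvGen.rel x y ?_
    -- The segment from κ x to κ y lies in the convex ball and in one fibre of p.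
    -- `Real.smoothTransition` takes values in [0, 1], so the curve is smooth and stays in the ball
    -- for all real times, as `JoinedAlong` demands.
    let c : ℝ → EuclideanSpace ℝ (Fin d) := fun t => κ x + Real.smoothTransition t • (κ y - κ x)
    have hcs : ContDiff ℝ ∞ c :=
      contDiff_const.add (Real.smoothTransition.contDiff.smul contDiff_const)
    have hct : ∀ t, c t ∈ κ.target := by
      intro t
      have hx := κ.map_source (hsrc x)
      have hy := κ.map_source (hsrc y)
      rw [ht] at hx hy ⊢
      exact (convex_ball _ _).add_smul_sub_mem hx hy
        ⟨Real.smoothTransition.nonneg t, Real.smoothTransition.le_one t⟩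
    have hγ : ContMDiff 𝓘(ℝ, ℝ) (𝓡 d) ∞ (fun t => κ.symm (c t)) := fun t =>
      ((contMDiffOn_symm_of_mem_maximalAtlas hκ).contMDiffAt
        (κ.open_target.mem_nhds (hct t))).comp t hcs.contMDiff.contMDiffAt
    refine ⟨fun t => κ.symm (c t), hγ, ?_, ?_, fun t => ?_⟩
    · simp [c, Real.smoothTransition.zero, κ.left_inv (hsrc x)]
    · simp [c, Real.smoothTransition.one, κ.left_inv (hsrc y)]
    · refine (hD _ _).2 ?_
      change p (tmap (𝓡 d) (𝓡 d) κ (κ.symm (c t))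
        (tmap 𝓘(ℝ, ℝ) (𝓡 d) (fun t => κ.symm (c t)) t 1)) = 0
      have hγd : MDifferentiableAt 𝓘(ℝ, ℝ) (𝓡 d) (fun t => κ.symm (c t)) t :=
        (hγ t).mdifferentiableAt (by simp)
      rw [← tmap_comp_apply 𝓘(ℝ, ℝ) (𝓡 d) (𝓡 d) t (hκd.mdifferentiableAt (hsrc _)) hγd]
      have h1 : κ ∘ (fun t => κ.symm (c t)) = c := funext fun t => κ.right_inv (hct t)
      rw [h1, tmap_eq_fderiv]
      have h2 : HasDerivAt c (deriv Real.smoothTransition t • (κ y - κ x)) t :=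
        ((Real.smoothTransition.contDiffAt (n := 1)).differentiableAt
          one_ne_zero).hasDerivAt.smul_const _ |>.const_add _
      have h3 : fderiv ℝ c t 1 = deriv Real.smoothTransition t • (κ y - κ x) := h2.deriv
      rw [h3, map_smul, map_sub, h, sub_self, smul_zero]

end Leaves

/-! ### The leaf space and its reduced form in a global chart. -/

section Reduction

/-- The pullback along a chart of a `2`-form on the model space. -/
def chartForm {m : ℕ} {N : Type*} [TopologicalSpace N]
    [ChartedSpace (EuclideanSpace ℝ (Fin m)) N]
    (e : OpenPartialHomeomorph N (EuclideanSpace ℝ (Fin m)))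
    (σ : EuclideanSpace ℝ (Fin m) → EuclideanSpace ℝ (Fin m) [⋀^Fin 2]→L[ℝ] ℝ) : TwoForm m N :=
  pullback (l := m) e σ

theorem bilAt_chartForm {m : ℕ} {N : Type*} [TopologicalSpace N]
    [ChartedSpace (EuclideanSpace ℝ (Fin m)) N]
    (e : OpenPartialHomeomorph N (EuclideanSpace ℝ (Fin m)))
    (σ : EuclideanSpace ℝ (Fin m) → EuclideanSpace ℝ (Fin m) [⋀^Fin 2]→L[ℝ] ℝ) (x : N)
    (v w : EuclideanSpace ℝ (Fin m)) : bilAt (chartForm e σ) x v w =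
      bil (σ (e x)) (tmap (𝓡 m) (𝓡 m) e x v) (tmap (𝓡 m) (𝓡 m) e x w) :=
  bil_compContinuousLinearMap (E := EuclideanSpace ℝ (Fin m)) (F := EuclideanSpace ℝ (Fin m))
    (σ (e x)) (tmap (𝓡 m) (𝓡 m) e x) v w

/-- A closed nondegenerate form on the image of a global chart defines a locally conformal
symplectic form on the manifold. -/
theorem isLocallyConformalSymplectic_pullback_chart {m : ℕ} {N : Type*} [TopologicalSpace N]
    [ChartedSpace (EuclideanSpace ℝ (Fin m)) N] [IsManifold (𝓡 m) ∞ N]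
    {e : OpenPartialHomeomorph N (EuclideanSpace ℝ (Fin m))}
    (he : atlas (EuclideanSpace ℝ (Fin m)) N = {e}) (hs : e.source = Set.univ)
    (σ : EuclideanSpace ℝ (Fin m) → EuclideanSpace ℝ (Fin m) [⋀^Fin 2]→L[ℝ] ℝ)
    (hσ : ContDiffOn ℝ ∞ σ e.target) (hd : ∀ y ∈ e.target, extDeriv σ y = 0)
    (hnd : ∀ y ∈ e.target, ∀ v, (∀ w, bil (σ y) v w = 0) → v = 0) :
    IsLocallyConformalSymplectic (chartForm e σ) := by
  have hea : e ∈ atlas (EuclideanSpace ℝ (Fin m)) N := by rw [he]; rfl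
  have hed : e.MDifferentiable (𝓡 m) (𝓡 m) :=
    mdifferentiable_of_mem_maximalAtlas (IsManifold.subset_maximalAtlas hea)
  have hsrc : ∀ x, x ∈ e.source := fun x => hs ▸ Set.mem_univ x
  have hrep : ∀ y ∈ e.target, chartRep (chartForm e σ) e y = σ y := by
    intro y hy
    apply bil_injective (E := EuclideanSpace ℝ (Fin m))
    ext v w
    rw [bil_chartRep, bilAt_chartForm, tmap_apply_tmap_symm hed hy, tmap_apply_tmap_symm hed hy,
      e.right_inv hy]
  -- Since e is the only chart of the atlas, smoothness and closedness need testing only there,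
  -- where the form is σ.
  have hsm : IsSmoothOn (chartForm e σ) Set.univ := by
    intro e' he'
    rw [he] at he'
    obtain rfl := he'
    exact (hσ.congr hrep).mono Set.inter_subset_left
  have hcl : IsClosedOn (chartForm e σ) Set.univ := by
    intro e' he' y hy
    rw [he] at he'
    obtain rfl := he'
    have h1 : chartRep (chartForm e' σ) e' =ᶠ[𝓝 y] σ := by
      filter_upwards [e'.open_target.mem_nhds hy.1] with z hz using hrep z hz
    rw [h1.extDeriv_eq]
    exact hd y hy.1
  have hno : IsNondegenerateOn (chartForm e σ) Set.univ := by
    rw [isNondegenerateOn_iff]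
    intro x _ v hv
    have h1 : tmap (𝓡 m) (𝓡 m) e x v = 0 := by
      refine hnd (e x) (e.map_source (hsrc x)) _ fun w => ?_
      have h2 := hv (tmap (𝓡 m) (𝓡 m) e.symm (e x) w)
      rw [bilAt_chartForm] at h2
      have h3 := tmap_apply_tmap_symm hed (e.map_source (hsrc x)) w
      rw [e.left_inv (hsrc x)] at h3
      rwa [h3] at h2
    have h4 := tmap_symm_apply_tmap hed (hsrc x) v
    rwa [h1, map_zero, eq_comm] at h4
  refine ⟨hsm, hno, fun x => ⟨Set.univ, isOpen_univ, trivial, fun _ => 1, contMDiffOn_const,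
    fun _ _ => one_pos, ?_⟩⟩
  have h1 : (fun y => (1 : ℝ) • (chartForm e σ) y : TwoForm m N) = chartForm e σ :=
    funext fun y => one_smul ℝ _
  rw [h1]
  exact ⟨hsm, hcl, hno⟩

variable {d k : ℕ} {Q : Type*} [TopologicalSpace Q] [ChartedSpace (EuclideanSpace ℝ (Fin d)) Q]
  {M : Type*} [TopologicalSpace M] [ChartedSpace (EuclideanSpace ℝ (Fin k)) M]

/-- Reduction along a submanifold with a global chart in which the pulled back form is, up to a
conformal factor, the pullback of a nondegenerate form along an orthogonal projection. -/
theorem isReducible_of_globalChart [Nonempty Q] (ι : Q → M) (Ω : TwoForm k M)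
    {κ : OpenPartialHomeomorph Q (EuclideanSpace ℝ (Fin d))}
    (hκ : κ ∈ IsManifold.maximalAtlas (𝓡 d) ∞ Q) (hs : κ.source = Set.univ) {r : ℝ}
    (ht : κ.target = Metric.ball 0 r) (f : Q → ℝ) (hf : ContMDiff (𝓡 d) 𝓘(ℝ, ℝ) ∞ f)
    (hf0 : ∀ x, 0 < f x) (K : Submodule ℝ (EuclideanSpace ℝ (Fin d)))
    (β : EuclideanSpace ℝ (Fin d) → EuclideanSpace ℝ (Fin d) [⋀^Fin 2]→L[ℝ] ℝ)
    (hβ : ContDiffOn ℝ ∞ β (Metric.ball 0 r)) (hd : ∀ y ∈ Metric.ball 0 r, extDeriv β y = 0)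
    (hinv : ∀ p ∈ Metric.ball (0 : EuclideanSpace ℝ (Fin d)) r, ∀ v w, bil (β p) v w =
      bil (β (p - K.starProjection p)) (v - K.starProjection v) (w - K.starProjection w))
    (hker : ∀ p ∈ Metric.ball (0 : EuclideanSpace ℝ (Fin d)) r, ∀ v,
      v ∈ K ↔ ∀ w, bil (β p) v w = 0)
    (hrel : ∀ x v w, bil (β (κ x)) (tmap (𝓡 d) (𝓡 d) κ x v) (tmap (𝓡 d) (𝓡 d) κ x w) =
      f x * bilAt Ω (ι x) (tmap (𝓡 d) (𝓡 k) ι x v) (tmap (𝓡 d) (𝓡 k) ι x w)) :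
    IsReducible d ι Ω := by
  have hsrc : ∀ z, z ∈ κ.source := fun z => hs ▸ Set.mem_univ z
  have hκd := mdifferentiable_of_mem_maximalAtlas hκ
  have hκb : ∀ z, κ z ∈ Metric.ball (0 : EuclideanSpace ℝ (Fin d)) r := fun z =>
    ht ▸ κ.map_source (hsrc z)
  let o := orthogonalModel K
  set m := Module.finrank ℝ Kᗮ
  set D := charDist d ι Ω with hDdef
  have hD : ∀ (x : Q) (v : EuclideanSpace ℝ (Fin d)),
      v ∈ (D x : Submodule ℝ (EuclideanSpace ℝ (Fin d))) ↔
        o.proj (tmap (𝓡 d) (𝓡 d) κ x v) = 0 := by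
    intro x v
    rw [o.proj_eq_zero_iff, hker (κ x) (hκb x), hDdef, mem_charDist_iff]
    constructor
    · intro h w
      have h1 := tmap_apply_tmap_symm hκd (κ.map_source (hsrc x)) w
      rw [κ.left_inv (hsrc x)] at h1
      rw [← h1, hrel, h, mul_zero]
    · intro h w
      have h1 := hrel x v w
      rw [h] at h1
      exact (mul_eq_zero.1 h1.symm).resolve_left (hf0 x).ne'
  have hleaf := leafSetoid_iff hκ hs ht o.proj D hD
  -- the leaf space as an open subset of the orthogonal complement
  let π := leafProj D
  let j : LeafSpace D → EuclideanSpace ℝ (Fin m) :=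
    Quotient.lift (fun x => o.proj (κ x)) fun x y h => (hleaf x y).1 h
  have hjπ : ∀ x, j (π x) = o.proj (κ x) := fun x => rfl
  have hπs : Function.Surjective π := Quotient.mk_surjective
  have hκo : IsOpenEmbedding κ := κ.isOpenEmbedding hs
  have hjc : Continuous j := (o.proj.continuous.comp hκo.continuous).quotient_lift _
  have hji : Function.Injective j := by
    intro a b hab
    obtain ⟨x, rfl⟩ := hπs a
    obtain ⟨y, rfl⟩ := hπs b
    exact Quotient.sound ((hleaf x y).2 hab)
  have hπc : Continuous π := continuous_quotient_mk'
  -- The image of V is that of the open set π⁻¹ V under the open map `o.proj` ∘ κ. The resulting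
  -- open embedding makes the leaf space Hausdorff, second countable and a manifold with one chart.
  have hjo : IsOpenMap j := by
    intro V hV
    have h1 : j '' V = o.proj '' (κ '' (π ⁻¹' V)) := by
      ext a
      constructor
      · rintro ⟨b, hb, rfl⟩
        obtain ⟨x, rfl⟩ := hπs b
        exact ⟨κ x, ⟨x, hb, rfl⟩, rfl⟩
      · rintro ⟨_, ⟨x, hx, rfl⟩, rfl⟩
        exact ⟨π x, hx, rfl⟩
    rw [h1]
    exact o.isOpenMap_proj _ (hκo.isOpenMap _ (hV.preimage hπc))
  have hj : IsOpenEmbedding j := .of_continuous_injective_isOpenMap hjc hji hjo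
  have hjr : ∀ a, a ∈ Set.range j ↔ a ∈ Metric.ball (0 : EuclideanSpace ℝ (Fin m)) r := by
    intro a
    constructor
    · rintro ⟨b, rfl⟩
      obtain ⟨x, rfl⟩ := hπs b
      exact o.proj_mem_ball (hκb x)
    · intro ha
      -- The inclusion is isometric, so it maps the ball of the complement into the ball of the same
      -- radius: j is onto that ball.
      have h1 : o.incl a ∈ κ.target := ht ▸ o.incl_mem_ball ha
      exact ⟨π (κ.symm (o.incl a)), by rw [hjπ, κ.right_inv h1, o.proj_incl]⟩
  have _hne : Nonempty (LeafSpace D) := ⟨π (Classical.arbitrary Q)⟩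
  let cs : ChartedSpace (EuclideanSpace ℝ (Fin m)) (LeafSpace D) := hj.singletonChartedSpace
  have hman : IsManifold (𝓡 m) ∞ (LeafSpace D) := hj.isManifold_singleton
  let e : OpenPartialHomeomorph (LeafSpace D) (EuclideanSpace ℝ (Fin m)) :=
    hj.toOpenPartialHomeomorph j
  have hes : e.source = Set.univ := rfl
  have het : e.target = Metric.ball 0 r := by
    rw [hj.toOpenPartialHomeomorph_target]
    exact Set.ext hjr
  have hea : atlas (EuclideanSpace ℝ (Fin m)) (LeafSpace D) = {e} := rfl
  have hemax : e ∈ IsManifold.maximalAtlas (𝓡 m) ∞ (LeafSpace D) :=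
    IsManifold.subset_maximalAtlas (by rw [hea]; rfl)
  have hed := mdifferentiable_of_mem_maximalAtlas hemax
  have hsub : Manifold.IsSubmersion (𝓡 d) (𝓡 m) ∞ π := by
    refine ⟨K, inferInstance, inferInstance, fun x => ?_⟩
    -- Read in κ and e, π is `o.proj`, the first component of the splitting.
    refine Manifold.IsSubmersionAtOfComplement.mk_of_charts o.splitting κ e (hsrc x) trivial hκ
      hemax (fun _ _ => trivial) ?_
    intro y hy
    have hy' : y ∈ κ.target := by simpa using hy
    change o.proj (κ (κ.symm y)) = o.proj y
    rw [κ.right_inv hy']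
  have hπd : ∀ x, MDifferentiableAt (𝓡 d) (𝓡 m) π x := fun x =>
    (hsub.contMDiff x).mdifferentiableAt (by simp)
  -- The reduced form is β restricted to the complement; `hinv` says that β is recovered from it by
  -- projection.
  let σ := flatPullback o.incl β
  have hσb : ∀ a v w, bil (σ a) v w = bil (β (o.incl a)) (o.incl v) (o.incl w) := by
    intro a v w
    have := bil_flatPullback o.incl β a v w
    rwa [o.incl.fderiv] at this
  have hmaps : Set.MapsTo o.incl (Metric.ball (0 : EuclideanSpace ℝ (Fin m)) r)
      (Metric.ball (0 : EuclideanSpace ℝ (Fin d)) r) := fun a ha => o.incl_mem_ball ha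
  refine ⟨m, cs, hman, hj.isEmbedding.t2Space, hj.isEmbedding.secondCountableTopology, hsub,
    (chartForm e σ), f, ?_, hf, hf0, ?_⟩
  · refine isLocallyConformalSymplectic_pullback_chart hea hes σ ?_ ?_ ?_
    · rw [het]
      exact contDiffOn_flatPullback Metric.isOpen_ball hβ o.incl.contDiff.contDiffOn hmaps
    · rw [het]
      exact extDeriv_flatPullback Metric.isOpen_ball Metric.isOpen_ball hβ
        o.incl.contDiff.contDiffOn hmaps hd
    · rw [het]
      intro a ha v hv
      have h1 : o.incl v ∈ K := by
        rw [hker (o.incl a) (hmaps ha)]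
        intro w
        rw [hinv _ (hmaps ha), o.starProjection_incl, o.starProjection_incl, ← o.incl_proj w,
          ← hσb]
        exact hv _
      rw [← o.proj_incl v]
      exact (o.proj_eq_zero_iff _).2 h1
  · intro x
    refine twoForm_ext (Ω := pullback π (chartForm e σ))
      (τ := fun y => f y • pullback ι Ω y) fun v w => ?_
    have h1 : ∀ v, tmap (𝓡 m) (𝓡 m) e (π x) (tmap (𝓡 d) (𝓡 m) π x v) =
        o.proj (tmap (𝓡 d) (𝓡 d) κ x v) := by
      intro v
      have hpd : MDifferentiableAt (𝓡 d) (𝓡 m) o.proj (κ x) :=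
        o.proj.differentiableAt.mdifferentiableAt
      rw [← tmap_comp_apply (𝓡 d) (𝓡 m) (𝓡 m) x (hed.mdifferentiableAt trivial) (hπd x)]
      have h2 := tmap_comp_apply (𝓡 d) (𝓡 d) (𝓡 m) x hpd (hκd.mdifferentiableAt (hsrc x)) v
      rw [tmap_eq_fderiv, o.proj.fderiv] at h2
      exact h2
    have h3 : bilAt (fun y => f y • pullback ι Ω y : TwoForm d Q) x v w =
        f x * bilAt Ω (ι x) (tmap (𝓡 d) (𝓡 k) ι x v) (tmap (𝓡 d) (𝓡 k) ι x w) := by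
      rw [bilAt_smul, bilAt_pullback]
    have h4 : bilAt (pullback π (chartForm e σ) : TwoForm d Q) x v w =
        bil (β (κ x)) (tmap (𝓡 d) (𝓡 d) κ x v) (tmap (𝓡 d) (𝓡 d) κ x w) := by
      rw [bilAt_pullback, bilAt_chartForm, h1, h1]
      change bil (σ (o.proj (κ x))) _ _ = _
      rw [hσb, hinv _ (hκb x), o.incl_proj, o.incl_proj]
      rw [o.incl_proj]
    refine h4.trans ((hrel x v w).trans h3.symm)

end Reduction

/-! ### Reducing charts around a point of a coisotropic submanifold. -/

section Charts

variable {d : ℕ} {Q : Type*} [TopologicalSpace Q] [ChartedSpace (EuclideanSpace ℝ (Fin d)) Q]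
  {k : ℕ} {M : Type*} [TopologicalSpace M] [ChartedSpace (EuclideanSpace ℝ (Fin k)) M]

/-- The differential of a map read in charts. -/
theorem fderiv_comp_charts {c : OpenPartialHomeomorph Q (EuclideanSpace ℝ (Fin d))}
    (hc : c ∈ IsManifold.maximalAtlas (𝓡 d) ∞ Q)
    {e : OpenPartialHomeomorph M (EuclideanSpace ℝ (Fin k))}
    (he : e ∈ IsManifold.maximalAtlas (𝓡 k) ∞ M) {ι : Q → M} (hι : ContMDiff (𝓡 d) (𝓡 k) ∞ ι)
    {y : EuclideanSpace ℝ (Fin d)} (hy : y ∈ c.target) (hye : ι (c.symm y) ∈ e.source)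
    (v : EuclideanSpace ℝ (Fin d)) :
    fderiv ℝ (e ∘ ι ∘ c.symm) y v = tmap (𝓡 k) (𝓡 k) e (ι (c.symm y))
      (tmap (𝓡 d) (𝓡 k) ι (c.symm y) (tmap (𝓡 d) (𝓡 d) c.symm y v)) := by
  have h1 : MDifferentiableAt (𝓡 d) (𝓡 d) c.symm y :=
    (mdifferentiable_of_mem_maximalAtlas hc).symm.mdifferentiableAt hy
  have h2 : MDifferentiableAt (𝓡 d) (𝓡 k) ι (c.symm y) := (hι _).mdifferentiableAt (by simp)
  have h3 : MDifferentiableAt (𝓡 k) (𝓡 k) e (ι (c.symm y)) :=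
    (mdifferentiable_of_mem_maximalAtlas he).mdifferentiableAt hye
  rw [← tmap_comp_apply (𝓡 d) (𝓡 d) (𝓡 k) y h2 h1, ← tmap_eq_fderiv]
  exact tmap_comp_apply (𝓡 d) (𝓡 k) (𝓡 k) y h3 (h2.comp y h1) v

theorem contDiffOn_comp_charts {c : OpenPartialHomeomorph Q (EuclideanSpace ℝ (Fin d))}
    (hc : c ∈ IsManifold.maximalAtlas (𝓡 d) ∞ Q)
    {e : OpenPartialHomeomorph M (EuclideanSpace ℝ (Fin k))}
    (he : e ∈ IsManifold.maximalAtlas (𝓡 k) ∞ M) {ι : Q → M} (hι : ContMDiff (𝓡 d) (𝓡 k) ∞ ι) :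
    ContDiffOn ℝ ∞ (e ∘ ι ∘ c.symm) (c.target ∩ c.symm ⁻¹' (ι ⁻¹' e.source)) := by
  refine ContMDiffOn.contDiffOn ?_
  exact (contMDiffOn_of_mem_maximalAtlas he).comp (hι.comp_contMDiffOn
    ((contMDiffOn_symm_of_mem_maximalAtlas hc).mono Set.inter_subset_left)) fun y hy => hy.2

variable [IsManifold (𝓡 d) ∞ Q]

/-- A chart followed by a diffeomorphism between open subsets of the model space is a chart. -/
theorem trans_mem_maximalAtlas {c : OpenPartialHomeomorph Q (EuclideanSpace ℝ (Fin d))}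
    (hc : c ∈ IsManifold.maximalAtlas (𝓡 d) ∞ Q)
    {Ψ : OpenPartialHomeomorph (EuclideanSpace ℝ (Fin d)) (EuclideanSpace ℝ (Fin d))}
    (hΨ : ContDiffOn ℝ ∞ Ψ Ψ.source) (hΨ' : ContDiffOn ℝ ∞ Ψ.symm Ψ.target) :
    c.trans Ψ ∈ IsManifold.maximalAtlas (𝓡 d) ∞ Q := by
  rw [IsManifold.mem_maximalAtlas_iff_contMDiffOn]
  constructor
  · refine hΨ.contMDiffOn.comp ((contMDiffOn_of_mem_maximalAtlas hc).mono fun x hx => ?_)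
      fun x hx => ?_
    · exact (c.trans_source Ψ ▸ hx).1
    · exact (c.trans_source Ψ ▸ hx).2
  · refine (contMDiffOn_symm_of_mem_maximalAtlas hc).comp (hΨ'.contMDiffOn.mono fun x hx => ?_)
      fun x hx => ?_
    · exact (c.trans_target Ψ ▸ hx).1
    · exact (c.trans_target Ψ ▸ hx).2

/-- The restriction of a compatible chart to an open subset is compatible. -/
theorem subtypeRestr_mem_maximalAtlas_of_mem {H X : Type*} [TopologicalSpace H]
    [TopologicalSpace X] [ChartedSpace H X] {G : StructureGroupoid H} [HasGroupoid X G]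
    [ClosedUnderRestriction G] {κ : OpenPartialHomeomorph X H} (hκ : κ ∈ G.maximalAtlas X)
    {U : TopologicalSpace.Opens X} (hU : Nonempty U) :
    κ.subtypeRestr hU ∈ G.maximalAtlas U := by
  intro e' he'
  obtain ⟨x, rfl⟩ := TopologicalSpace.Opens.chart_eq hU he'
  have hx := hκ _ (chart_mem_atlas H (x : X))
  exact ⟨G.mem_of_eqOnSource (closedUnderRestriction' hx.1 (κ.isOpen_inter_preimage_symm U.2))
      (κ.subtypeRestr_symm_trans_subtypeRestr hU _),
    G.mem_of_eqOnSource (closedUnderRestriction' hx.2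
      ((chartAt H (x : X)).isOpen_inter_preimage_symm U.2))
      (OpenPartialHomeomorph.subtypeRestr_symm_trans_subtypeRestr hU _ κ)⟩

theorem exists_centered_chart (q : Q) :
    ∃ c ∈ IsManifold.maximalAtlas (𝓡 d) ∞ Q, q ∈ c.source ∧ c q = 0 := by
  let c₀ := chartAt (EuclideanSpace ℝ (Fin d)) q
  refine ⟨c₀.trans (Homeomorph.addRight (-(c₀ q))).toOpenPartialHomeomorph,
    trans_mem_maximalAtlas (IsManifold.chart_mem_maximalAtlas q) ?_ ?_, ?_, ?_⟩
  · exact (contDiff_id.add contDiff_const).contDiffOn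
  · exact (contDiff_id.add contDiff_const).contDiffOn
  · simp [c₀]
  · simp [c₀]

/-- The radical of a bilinear form. -/
def radical {E : Type*} [NormedAddCommGroup E] [NormedSpace ℝ E] (f : E [⋀^Fin 2]→L[ℝ] ℝ) :
    Submodule ℝ E := LinearMap.ker (bil f).toLinearMap

theorem mem_radical {E : Type*} [NormedAddCommGroup E] [NormedSpace ℝ E]
    (f : E [⋀^Fin 2]→L[ℝ] ℝ) (v : E) : v ∈ radical f ↔ ∀ w, bil f v w = 0 := by
  refine LinearMap.mem_ker.trans ?_
  exact DFunLike.ext_iff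

variable [IsManifold (𝓡 k) ∞ M]

/-- Every point of a coisotropic submanifold has a small chart in which the form is, up to a
conformal factor, closed and the pullback of a form along an orthogonal projection. -/
theorem exists_reducing_chart (Ω : TwoForm k M) (hΩ : IsLocallyConformalSymplectic Ω)
    (ι : Q → M) (hι : Manifold.IsImmersion (𝓡 d) (𝓡 k) ∞ ι) (hQ : IsCoisotropic d ι Ω)
    (q : Q) (W : Set Q) (hW : W ∈ 𝓝 q) :
    ∃ κ ∈ IsManifold.maximalAtlas (𝓡 d) ∞ Q, q ∈ κ.source ∧ κ.source ⊆ W ∧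
      ∃ r, κ.target = Metric.ball 0 r ∧
      ∃ f : Q → ℝ, ContMDiffOn (𝓡 d) 𝓘(ℝ, ℝ) ∞ f κ.source ∧ (∀ x ∈ κ.source, 0 < f x) ∧
      ∃ (K : Submodule ℝ (EuclideanSpace ℝ (Fin d)))
        (β : EuclideanSpace ℝ (Fin d) → EuclideanSpace ℝ (Fin d) [⋀^Fin 2]→L[ℝ] ℝ),
        ContDiffOn ℝ ∞ β (Metric.ball 0 r) ∧ (∀ y ∈ Metric.ball 0 r, extDeriv β y = 0) ∧
        (∀ p ∈ Metric.ball (0 : EuclideanSpace ℝ (Fin d)) r, ∀ v w, bil (β p) v w =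
          bil (β (p - K.starProjection p)) (v - K.starProjection v) (w - K.starProjection w)) ∧
        (∀ p ∈ Metric.ball (0 : EuclideanSpace ℝ (Fin d)) r, ∀ v,
          v ∈ K ↔ ∀ w, bil (β p) v w = 0) ∧
        ∀ x ∈ κ.source, ∀ v w,
          bil (β (κ x)) (tmap (𝓡 d) (𝓡 d) κ x v) (tmap (𝓡 d) (𝓡 d) κ x w) =
            f x * bilAt Ω (ι x) (tmap (𝓡 d) (𝓡 k) ι x v) (tmap (𝓡 d) (𝓡 k) ι x w) := by
  have hιs : ContMDiff (𝓡 d) (𝓡 k) ∞ ι := hι.contMDiff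
  obtain ⟨A, hA, hqA, f, hf, hf0, hsymp⟩ := hΩ.locally_conformal (ι q)
  set e := chartAt (EuclideanSpace ℝ (Fin k)) (ι q)
  have hea : e ∈ atlas (EuclideanSpace ℝ (Fin k)) M := chart_mem_atlas _ _
  have hem : e ∈ IsManifold.maximalAtlas (𝓡 k) ∞ M := IsManifold.subset_maximalAtlas hea
  have hed := mdifferentiable_of_mem_maximalAtlas hem
  have hqe : ι q ∈ e.source := mem_chart_source _ _
  obtain ⟨c, hc, hqc, hcq⟩ := exists_centered_chart (d := d) q
  have hcd := mdifferentiable_of_mem_maximalAtlas hc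
  -- The closed multiple of Ω, read below in the chart e of M as η on T.
  set fΩ : TwoForm k M := fun y => f y • Ω y with hfΩ
  set η := chartRep fΩ e
  set T := e.target ∩ e.symm ⁻¹' A
  have hT : IsOpen T := e.isOpen_inter_preimage_symm hA
  have hη : ContDiffOn ℝ ∞ η T := hsymp.smooth e hea
  have hηd : ∀ z ∈ T, extDeriv η z = 0 := hsymp.closed e hea
  have hηe : ∀ x ∈ e.source, ∀ v w, bil (η (e x)) (tmap (𝓡 k) (𝓡 k) e x v)
      (tmap (𝓡 k) (𝓡 k) e x w) = f x * bilAt Ω x v w := by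
    intro x hx v w
    rw [bil_chartRep, tmap_symm_apply_tmap hed hx, tmap_symm_apply_tmap hed hx, e.left_inv hx]
    exact bilAt_smul Ω f x v w
  have hηnd : ∀ z ∈ T, ∀ v, (∀ w, bil (η z) v w = 0) → v = 0 := by
    intro z hz v hv
    have h1 : tmap (𝓡 k) (𝓡 k) e.symm z v = 0 := by
      refine (isNondegenerateOn_iff fΩ A).1 hsymp.nondegenerate _ hz.2 _ fun w => ?_
      have h2 := hv (tmap (𝓡 k) (𝓡 k) e (e.symm z) w)
      have h3 := tmap_symm_apply_tmap hed (e.map_target hz.1) w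
      rw [e.right_inv hz.1] at h3
      rwa [bil_chartRep, h3] at h2
    have h2 := tmap_apply_tmap_symm hed hz.1 v
    rwa [h1, map_zero, eq_comm] at h2
  let g := e ∘ ι ∘ c.symm
  -- The points of Q inside W whose image lies both in the chart domain and where f Ω is symplectic.
  set S : Set Q := interior W ∩ ι ⁻¹' (e.source ∩ A)
  have hS : IsOpen S :=
    isOpen_interior.inter ((e.open_source.inter hA).preimage hιs.continuous)
  have hqS : q ∈ S := ⟨mem_interior_iff_mem_nhds.2 hW, hqe, hqA⟩
  set V := c.target ∩ c.symm ⁻¹' S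
  have hV : IsOpen V := c.isOpen_inter_preimage_symm hS
  have h0 : (0 : EuclideanSpace ℝ (Fin d)) ∈ V := by
    refine ⟨hcq ▸ c.map_source hqc, ?_⟩
    change c.symm 0 ∈ S
    rwa [← hcq, c.left_inv hqc]
  have hg : ContDiffOn ℝ ∞ g V :=
    (contDiffOn_comp_charts hc hem hιs).mono fun y hy => ⟨hy.1, hy.2.2.1⟩
  have hgT : Set.MapsTo g V T := fun y hy =>
    ⟨e.map_source hy.2.2.1, by
      change e.symm (e (ι (c.symm y))) ∈ A
      rw [e.left_inv hy.2.2.1]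
      exact hy.2.2.2⟩
  have hgd : ∀ y ∈ V, ∀ v, fderiv ℝ g y v = tmap (𝓡 k) (𝓡 k) e (ι (c.symm y))
      (tmap (𝓡 d) (𝓡 k) ι (c.symm y) (tmap (𝓡 d) (𝓡 d) c.symm y v)) := fun y hy v =>
    fderiv_comp_charts hc hem hιs hy.1 hy.2.2.1 v
  have hinj : Function.Injective (fderiv ℝ g 0) := by
    intro v w hvw
    rw [hgd 0 h0, hgd 0 h0] at hvw
    have h1 := congrArg (tmap (𝓡 k) (𝓡 k) e.symm (e (ι (c.symm 0)))) hvw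
    rw [tmap_symm_apply_tmap hed h0.2.2.1, tmap_symm_apply_tmap hed h0.2.2.1] at h1
    have h2 := congrArg (tmap (𝓡 d) (𝓡 d) c (c.symm 0))
      (injective_tmap_of_isImmersion hι _ h1)
    rwa [tmap_apply_tmap_symm hcd h0.1, tmap_apply_tmap_symm hcd h0.1] at h2
  have hco : ∀ y ∈ V, ∀ v, (∀ w, bil (η (g y)) v (fderiv ℝ g y w) = 0) →
      ∃ w, fderiv ℝ g y w = v := by
    intro y hy v hv
    set x := c.symm y with hx
    have hxe : ι x ∈ e.source := hy.2.2.1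
    obtain ⟨w, hw⟩ := (isCoisotropic_iff ι Ω).1 hQ x (tmap (𝓡 k) (𝓡 k) e.symm (e (ι x)) v) (by
      intro w
      have h1 := hv (tmap (𝓡 d) (𝓡 d) c x w)
      have h2 := tmap_symm_apply_tmap hcd (c.map_target hy.1) w
      rw [c.right_inv hy.1] at h2
      rw [hgd y hy, h2] at h1
      have h3 := tmap_apply_tmap_symm hed (e.map_source hxe) v
      rw [e.left_inv hxe] at h3
      rw [← h3] at h1
      have h4 := (hηe (ι x) hxe (tmap (𝓡 k) (𝓡 k) e.symm (e (ι x)) v)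
        (tmap (𝓡 d) (𝓡 k) ι x w)).symm.trans h1
      exact (mul_eq_zero.1 h4).resolve_left (hf0 _ hy.2.2.2).ne')
    refine ⟨tmap (𝓡 d) (𝓡 d) c x w, ?_⟩
    have h2 := tmap_symm_apply_tmap hcd (c.map_target hy.1) w
    rw [c.right_inv hy.1] at h2
    rw [hgd y hy, h2, ← hx, hw]
    have h3 := tmap_apply_tmap_symm hed (e.map_source hxe) v
    rwa [e.left_inv hxe] at h3
  let K := radical (flatPullback g η 0)
  have hK : ∀ v, v ∈ K ↔ ∀ w, bil (flatPullback g η 0) v w = 0 := mem_radical _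
  obtain ⟨V', hV'V, hV', h0V', X, hX, hX0, hXker⟩ := exists_kernel_sections hV h0 hg hη hgT hηnd
    hinj hco K.starProjection fun v w => (hK _).1 (K.starProjection_apply_mem v) w
  have hβ : ContDiffOn ℝ ∞ (flatPullback g η) V := contDiffOn_flatPullback hV hη hg hgT
  have hβd : ∀ y ∈ V, extDeriv (flatPullback g η) y = 0 :=
    extDeriv_flatPullback hV hT hη hg hgT hηd
  obtain ⟨r, hr, Φ, hΦs, hΦt, hΦ0, hΦ, hΦ', hΦi, hΦk⟩ := exists_normalForm hV' h0V'
    (hβ.mono hV'V) (fun y hy => hβd y (hV'V hy)) hX hXker K hX0 hK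
  have hΦV : ∀ p ∈ Metric.ball 0 r, Φ p ∈ V := fun p hp =>
    hV'V (hΦt (Φ.map_source (hΦs ▸ hp)))
  have h0r : (0 : EuclideanSpace ℝ (Fin d)) ∈ Φ.source := hΦs ▸ Metric.mem_ball_self hr
  have hκs : ∀ x, x ∈ (c.trans Φ.symm).source ↔ x ∈ c.source ∧ c x ∈ Φ.target := fun x => by
    rw [c.trans_source, Φ.symm_source]
    rfl
  have hκS : ∀ x ∈ (c.trans Φ.symm).source, x ∈ S := by
    intro x hx
    rw [hκs] at hx
    have h1 := (hV'V (hΦt hx.2)).2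
    rwa [Set.mem_preimage, c.left_inv hx.1] at h1
  have hΦm : Set.MapsTo Φ (Metric.ball 0 r) V := hΦV
  -- The reducing chart is c followed by the inverse of the straightening map Φ, so its image is the
  -- ball on which the normal form holds.
  have hκm : c.trans Φ.symm ∈ IsManifold.maximalAtlas (𝓡 d) ∞ Q :=
    trans_mem_maximalAtlas hc hΦ' (by simpa using hΦ)
  refine ⟨c.trans Φ.symm, hκm, ?_,
    fun x hx => interior_subset (hκS x hx).1, r, ?_, f ∘ ι, ?_,
    fun x hx => hf0 _ (hκS x hx).2.2, K, flatPullback Φ (flatPullback g η), ?_, ?_, hΦi, hΦk, ?_⟩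
  · rw [hκs, hcq]
    exact ⟨hqc, hΦ0 ▸ Φ.map_source h0r⟩
  · rw [c.trans_target, Φ.symm_target, Φ.symm_symm, hΦs]
    exact Set.inter_eq_left.2 fun p hp => (hΦV p hp).1
  · exact hf.comp hιs.contMDiffOn fun x hx => (hκS x hx).2.2
  · exact contDiffOn_flatPullback Metric.isOpen_ball hβ (hΦs ▸ hΦ) hΦm
  · exact extDeriv_flatPullback Metric.isOpen_ball hV hβ (hΦs ▸ hΦ) hΦm hβd
  · intro x hx v w
    set κ := c.trans Φ.symm
    have hx' := (hκs x).1 hx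
    have hκd := mdifferentiable_of_mem_maximalAtlas hκm
    have hκx : κ x ∈ Φ.source := Φ.map_target hx'.2
    have hΦκ : Φ (κ x) = c x := Φ.right_inv hx'.2
    have hΦdiff : MDifferentiableAt (𝓡 d) (𝓡 d) Φ (κ x) :=
      ((hΦ.contDiffAt (Φ.open_source.mem_nhds hκx)).differentiableAt
        (by simp)).mdifferentiableAt
    have h1 : ∀ v, fderiv ℝ Φ (κ x) (tmap (𝓡 d) (𝓡 d) κ x v) = tmap (𝓡 d) (𝓡 d) c x v := by
      intro v
      rw [← tmap_eq_fderiv, ← tmap_comp_apply (𝓡 d) (𝓡 d) (𝓡 d) x hΦdiff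
        (hκd.mdifferentiableAt hx)]
      rw [tmap_congr (𝓡 d) (𝓡 d) (h := c)]
      filter_upwards [κ.open_source.mem_nhds hx] with z hz using Φ.right_inv ((hκs z).1 hz).2
    have h2 : ∀ v, fderiv ℝ g (c x) (tmap (𝓡 d) (𝓡 d) c x v) =
        tmap (𝓡 k) (𝓡 k) e (ι x) (tmap (𝓡 d) (𝓡 k) ι x v) := by
      intro v
      rw [hgd (c x) (hV'V (hΦt hx'.2)), tmap_symm_apply_tmap hcd hx'.1, c.left_inv hx'.1]
    have h3 : g (c x) = e (ι x) := by
      change e (ι (c.symm (c x))) = _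
      rw [c.left_inv hx'.1]
    rw [bil_flatPullback, bil_flatPullback, h1, h1, hΦκ, h2, h2, h3]
    exact hηe (ι x) (hκS x hx).2.1 _ _

/-- Every point of a coisotropic submanifold has arbitrarily small open neighbourhoods along which
the locally conformal symplectic structure can be reduced. -/
theorem exists_isReducible_nhds (Ω : TwoForm k M) (hΩ : IsLocallyConformalSymplectic Ω)
    (ι : Q → M) (hι : Manifold.IsImmersion (𝓡 d) (𝓡 k) ∞ ι) (hQ : IsCoisotropic d ι Ω)
    (q : Q) (W : Set Q) (hW : W ∈ 𝓝 q) :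
    ∃ U : TopologicalSpace.Opens Q, q ∈ U ∧ (U : Set Q) ⊆ W ∧
      IsReducible d (fun x : U => ι x) Ω := by
  obtain ⟨κ, hκ, hq, hsub, r, ht, f, hf, hf0, K, β, hβ, hd, hinv, hker, hrel⟩ :=
    exists_reducing_chart Ω hΩ ι hι hQ q W hW
  -- With the full chart domain as neighbourhood, κ restricts to a global chart of U with the same
  -- ball as target.
  let U : TopologicalSpace.Opens Q := ⟨κ.source, κ.open_source⟩
  have hU : Nonempty U := ⟨⟨q, hq⟩⟩
  refine ⟨U, hq, hsub, ?_⟩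
  let κ' := κ.subtypeRestr hU
  have hκ' : κ' ∈ IsManifold.maximalAtlas (𝓡 d) ∞ U :=
    subtypeRestr_mem_maximalAtlas_of_mem hκ hU
  have hval : ∀ x : U, MDifferentiableAt (𝓡 d) (𝓡 d) (Subtype.val : U → Q) x := fun x =>
    (contMDiff_subtype_val (n := ∞) x).mdifferentiableAt (by simp)
  have hιs : ContMDiff (𝓡 d) (𝓡 k) ∞ ι := hι.contMDiff
  refine isReducible_of_globalChart (fun x : U => ι x) Ω hκ' ?_ (r := r) ?_ (fun x => f x) ?_
    (fun x => hf0 x x.2) K β hβ hd hinv hker fun x v w => ?_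
  · ext x
    simp [κ', U]
  · rw [← ht]
    refine (κ.subtypeRestr_target_subset hU).antisymm fun y hy => ?_
    rw [← κ.right_inv hy]
    exact κ.map_subtype_source hU (x := ⟨κ.symm y, κ.map_target hy⟩) (κ.map_target hy)
  · exact fun x => (hf.contMDiffAt (κ.open_source.mem_nhds x.2)).comp x
      (contMDiff_subtype_val x)
  · have h1 : ∀ v, tmap (𝓡 d) (𝓡 d) κ' x v =
        tmap (𝓡 d) (𝓡 d) κ x (tmap (𝓡 d) (𝓡 d) (Subtype.val : U → Q) x v) := fun v =>
      tmap_comp_apply (𝓡 d) (𝓡 d) (𝓡 d) x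
        ((mdifferentiable_of_mem_maximalAtlas hκ).mdifferentiableAt x.2) (hval x) v
    have h2 : ∀ v, tmap (𝓡 d) (𝓡 k) (fun x : U => ι x) x v =
        tmap (𝓡 d) (𝓡 k) ι x (tmap (𝓡 d) (𝓡 d) (Subtype.val : U → Q) x v) := fun v =>
      tmap_comp_apply (𝓡 d) (𝓡 d) (𝓡 k) x ((hιs _).mdifferentiableAt (by simp)) (hval x) v
    rw [h1, h1, h2, h2]
    exact hrel x x.2 _ _

end Charts

end

end LCS

theorem mainTheorem6 (n d : ℕ) (hn : 2 < 2 * n)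
    {M : Type*} [TopologicalSpace M] [ChartedSpace (EuclideanSpace ℝ (Fin (2 * n))) M]
    [IsManifold (𝓡 (2 * n)) ∞ M]
    (Ω : LCS.TwoForm (2 * n) M) (hΩ : LCS.IsLocallyConformalSymplectic Ω)
    {Q : Type*} [TopologicalSpace Q] [ChartedSpace (EuclideanSpace ℝ (Fin d)) Q]
    [IsManifold (𝓡 d) ∞ Q]
    (ι : Q → M) (hι : Manifold.IsSmoothEmbedding (𝓡 d) (𝓡 (2 * n)) ∞ ι)
    (hQ : LCS.IsCoisotropic d ι Ω) (q : Q) (W : Set Q) (hW : W ∈ nhds q) :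
    ∃ U : TopologicalSpace.Opens Q, q ∈ U ∧ (U : Set Q) ⊆ W ∧
      LCS.IsReducible d (fun x : U => ι x) Ω := by
  exact LCS.exists_isReducible_nhds Ω hΩ ι hι.isImmersion hQ q W hW
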